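/- Let $G$ be a discrete group with identity $e$ and let $B$ be a unital C$^*$-algebra. A Morita equivalence $B$-bimodule is a $B$-bimodule that is a full left and a full right Hilbert $B$-module, with inner products satisfying ${}_B\langle x,y\rangle z = x\langle y,z\rangle_B$ and with each action adjointable for the other inner product; isomorphisms are the $B$-bimodule isomorphisms preserving both inner products. $\mathrm{Pic}(B)$ is the group of isomorphism classes $[M]$, with multiplication induced by the internal tensor product $\otimes_B$ and neutral element $[B]$. Let $UZ(B)$ be the group of unitary elements of the center of $B$. For each $M$ there is an automorphism $\psi_M$ of $UZ(B)$ determined by $xu=\psi_M(u)x$ for all $x\in M$, $u\in UZ(B)$; a homomorphism $\psi:G\to\mathrm{Pic}(B)$ thus makes $UZ(B)$ a $G$-module by $g\cdot u:=\psi_M(u)$ for $[M]=\psi(g)$. Let $H^2(G,UZ(B))_\psi=Z^2/B^2$ be the corresponding second cohomology group, where $Z^2$ consists of the maps $\omega:G\times G\to UZ(B)$ with $\omega(e,g)=\omega(g,e)=1$ and $(g\cdot\omega(h,k))\,\omega(g,hk)=\omega(gh,k)\,\omega(g,h)$, and $B^2$ of the maps $(g,h)\mapsto (g\cdot\varpi(h))\,\varpi(gh)^{-1}\varpi(g)$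 with $\varpi:G\to UZ(B)$, $\varpi(e)=1$. A saturated Fell bundle over $G$ with unit fiber $B$ is a family of Banach spaces $(B_g)_{g\in G}$ with $B_e=B$, bilinear multiplications $B_g\times B_h\to B_{gh}$ and antilinear involutions $B_g\to B_{g^{-1}}$, extending those of $B$, such that multiplication is associative, $\|st\|\le\|s\|\|t\|$, $(st)^*=t^*s^*$, $s^{**}=s$, $\|s^*s\|=\|s\|^2$, $s^*s\ge 0$ in $B$, and $\mathrm{span}(B_gB_h)$ is dense in $B_{gh}$. Two such bundles are equivalent if there are surjective linear isometries between their fibers over each $g$ that respect multiplication and involution and are the identity on $B_e=B$. Each fiber $B_g$ is a Morita equivalence $B$-bimodule with ${}_B\langle s,t\rangle=st^*$ and $\langle s,t\rangle_B=s^*t$. For a homomorphism $\psi:G\to\mathrm{Pic}(B)$ let $\mathrm{Ext}(G,B,\psi)$ be the set of equivalence classes of saturated Fell bundles over $G$ with unit fiber $B$ such that $[B_g]=\psi(g)$ for all $g$. A factor system for $\psi$ is a family $(B_g,\Psi_{g,h})_{g,h\in G}$ of Morita equivalence $B$-bimodules $B_g$ with $[B_g]=\psi(g)$ and $B_e=B$,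 and of Morita equivalence $B$-bimodule isomorphisms $\Psi_{g,h}:B_g\otimes_B B_h\to B_{gh}$, with $\Psi_{e,e}$ the multiplication of $B$, such that $\Psi_{gh,k}\circ(\Psi_{g,h}\otimes\mathrm{id})=\Psi_{g,hk}\circ(\mathrm{id}\otimes\Psi_{h,k})$ for all $g,h,k\in G$. It defines a saturated Fell bundle $\mathcal B((B_g,\Psi_{g,h})_{g,h\in G})$ with fibers $B_g$, multiplication $st=\Psi_{g,h}(s\otimes t)$ and involution $s^*=\lambda_s^*(1_B)$ for $s\in B_g$, where $\lambda_s:B_{g^{-1}}\to B$, $\lambda_s(t)=\Psi_{g,g^{-1}}(s\otimes t)$, and $\lambda_s^*$ is its adjoint for the right inner products. For $\omega\in Z^2$, $(B_g,\omega(g,h)\Psi_{g,h})_{g,h\in G}$ is again a factor system for $\psi$. **Corollary.** Let $\psi:G\to\mathrm{Pic}(B)$ be a group homomorphism with $\mathrm{Ext}(G,B,\psi)\neq\emptyset$. Then every class in $\mathrm{Ext}(G,B,\psi)$ is of the form $[\mathcal B((B_g,\Psi_{g,h})_{g,h\in G})]$ for a factor system for $\psi$, and $$H^2(G,UZ(B))_\psi\times\mathrm{Ext}(G,B,\psi)\to\mathrm{Ext}(G,B,\psi),\qquad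 \big([\omega],[\mathcal B((B_g,\Psi_{g,h})_{g,h\in G})]\big)\mapsto[\mathcal B((B_g,\omega(g,h)\Psi_{g,h})_{g,h\in G})]$$ is a well-defined group action which is simply transitive: for all $x,y\in\mathrm{Ext}(G,B,\psi)$ there is exactly one $c\in H^2(G,UZ(B))_\psi$ with $c\cdot x=y$. -/

import Mathlib

open scoped RightActions

universe u v

set_option linter.unusedSectionVars false

/-! ## Morita equivalence bimodules and the Picard group -/

/-- A Morita equivalence `B`-bimodule over a unital C⋆-algebra `B`: a Banach space with commuting
left and right `B`-actions and with a left and a right `B`-valued inner product making it a full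
left and a full right Hilbert `B`-module (for the same norm), such that each action is by adjointable
operators for the inner product on the other side and `⟪x, y⟫_L z = x ⟪y, z⟫_R`.
The right action of `b` on `x` is written `x <• b`. -/
structure MoritaBimodule (B : Type u) [CStarAlgebra B] [PartialOrder B] [StarOrderedRing B] where
  carrier : Type u
  [normedAddCommGroup : NormedAddCommGroup carrier]
  [normedSpace : NormedSpace ℂ carrier]
  [completeSpace : CompleteSpace carrier]
  [leftModule : Module B carrier]
  [rightModule : Module Bᵐᵒᵖ carrier]
  [smulCommClass : SMulCommClass B Bᵐᵒᵖ carrier]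
  [leftTower : IsScalarTower ℂ B carrier]
  [rightTower : IsScalarTower ℂ Bᵐᵒᵖ carrier]
  /-- the left inner product `_B⟨x, y⟩`, linear in `x` -/
  innerL : carrier → carrier → B
  /-- the right inner product `⟨x, y⟩_B`, linear in `y` -/
  innerR : carrier → carrier → B
  innerL_add : ∀ x y z, innerL (x + y) z = innerL x z + innerL y z
  innerL_smul : ∀ (b : B) x y, innerL (b • x) y = b * innerL x y
  star_innerL : ∀ x y, star (innerL x y) = innerL y x
  innerL_self_nonneg : ∀ x, 0 ≤ innerL x x
  norm_innerL_self : ∀ x, ‖innerL x x‖ = ‖x‖ ^ 2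
  innerL_full : Dense
    (Submodule.span ℂ (Set.range fun p : carrier × carrier => innerL p.1 p.2) : Set B)
  innerR_add : ∀ x y z, innerR x (y + z) = innerR x y + innerR x z
  innerR_smul : ∀ x y (b : B), innerR x (y <• b) = innerR x y * b
  star_innerR : ∀ x y, star (innerR x y) = innerR y x
  innerR_self_nonneg : ∀ x, 0 ≤ innerR x x
  norm_innerR_self : ∀ x, ‖innerR x x‖ = ‖x‖ ^ 2
  innerR_full : Dense
    (Submodule.span ℂ (Set.range fun p : carrier × carrier => innerR p.1 p.2) : Set B)
  innerR_adjoint : ∀ (b : B) x y, innerR (b • x) y = innerR x (star b • y)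
  innerL_adjoint : ∀ x (b : B) y, innerL (x <• b) y = innerL x (y <• star b)
  innerL_smul_eq : ∀ x y z, innerL x y • z = x <• innerR y z

section Basics

variable {B : Type u} [CStarAlgebra B] [PartialOrder B] [StarOrderedRing B]

namespace MoritaBimodule

instance : CoeSort (MoritaBimodule B) (Type u) := ⟨carrier⟩

attribute [instance] normedAddCommGroup normedSpace completeSpace leftModule rightModule
  smulCommClass leftTower rightTower

/-- An isomorphism of Morita equivalence bimodules: a bijective bimodule map that preserves both
inner products. -/
structure Iso (M N : MoritaBimodule B) extends M ≃ₗ[B] N where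
  map_op_smul' : ∀ x (b : B), toFun (x <• b) = toFun x <• b
  map_innerL' : ∀ x y, N.innerL (toFun x) (toFun y) = M.innerL x y
  map_innerR' : ∀ x y, N.innerR (toFun x) (toFun y) = M.innerR x y

instance (M N : MoritaBimodule B) : CoeFun (Iso M N) (fun _ => M → N) := ⟨fun f => f.toFun⟩

/-- A Morita equivalence bimodule isomorphism `M ⊗_B N ≅ P` out of the internal (completed, balanced)
tensor product, given by its values `(x, y) ↦ x ⊗ y` on elementary tensors: a biadditive,
`B`-balanced map compatible with the two outer actions, carrying the inner products
`⟨x ⊗ y, x' ⊗ y'⟩_B = ⟨y, ⟨x, x'⟩_B y'⟩_B` and `_B⟨x ⊗ y, x' ⊗ y'⟩ = _B⟨x _B⟨y, y'⟩, x'⟩` of the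
tensor product to those of `P`, and with dense linear range. -/
structure TensorIso (M N P : MoritaBimodule B) where
  toFun : M → N → P
  add_left : ∀ x x' y, toFun (x + x') y = toFun x y + toFun x' y
  add_right : ∀ x y y', toFun x (y + y') = toFun x y + toFun x y'
  smul_left : ∀ (b : B) x y, toFun (b • x) y = b • toFun x y
  smul_right : ∀ x y (b : B), toFun x (y <• b) = toFun x y <• b
  balanced : ∀ x (b : B) y, toFun (x <• b) y = toFun x (b • y)
  innerL_map : ∀ x y x' y',
    P.innerL (toFun x y) (toFun x' y') = M.innerL (x <• N.innerL y y') x'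
  innerR_map : ∀ x y x' y',
    P.innerR (toFun x y) (toFun x' y') = N.innerR y (M.innerR x x' • y')
  dense_range : Dense
    (Submodule.span ℂ (Set.range fun p : M × N => toFun p.1 p.2) : Set P)

instance (M N P : MoritaBimodule B) : CoeFun (TensorIso M N P) (fun _ => M → N → P) :=
  ⟨fun f => f.toFun⟩

variable (B) in
/-- `B` as a Morita equivalence bimodule over itself. -/
noncomputable def self : MoritaBimodule B where
  carrier := B
  innerL x y := x * star y
  innerR x y := star x * y
  innerL_add := by intros; simp [add_mul]
  innerL_smul := by intros; simp [mul_assoc]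
  star_innerL := by intros; simp
  innerL_self_nonneg := mul_star_self_nonneg
  norm_innerL_self := by intro x; rw [CStarRing.norm_self_mul_star, sq]
  innerL_full := by
    convert dense_univ
    refine Set.eq_univ_of_forall fun b => Submodule.subset_span ⟨(b, 1), by simp⟩
  innerR_add := by intros; simp [mul_add]
  innerR_smul := by intros; simp [mul_assoc]
  star_innerR := by intros; simp
  innerR_self_nonneg := star_mul_self_nonneg
  norm_innerR_self := by intro x; rw [CStarRing.norm_star_mul_self, sq]
  innerR_full := by
    convert dense_univ
    refine Set.eq_univ_of_forall fun b => Submodule.subset_span ⟨(1, b), by simp⟩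
  innerR_adjoint := by intros; simp [mul_assoc]
  innerL_adjoint := by intros; simp [mul_assoc]
  innerL_smul_eq := by intros; simp [mul_assoc]

variable {M N P Q : MoritaBimodule B}

namespace Iso

lemma map_act (f : Iso M N) (b : B) (x : M) : f (b • x) = b • f x := f.toLinearEquiv.map_smul b x
lemma map_op (f : Iso M N) (x : M) (b : B) : f (x <• b) = f x <• b := f.map_op_smul' x b
lemma map_innerL (f : Iso M N) (x y : M) : N.innerL (f x) (f y) = M.innerL x y := f.map_innerL' x y
lemma map_innerR (f : Iso M N) (x y : M) : N.innerR (f x) (f y) = M.innerR x y := f.map_innerR' x y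
lemma surj (f : Iso M N) (y : N) : ∃ x, f x = y := f.toLinearEquiv.surjective y

/-- The identity isomorphism. -/
def refl (M : MoritaBimodule B) : Iso M M where
  toLinearEquiv := LinearEquiv.refl B M
  map_op_smul' _ _ := rfl
  map_innerL' _ _ := rfl
  map_innerR' _ _ := rfl

/-- The inverse isomorphism. -/
def symm (f : Iso M N) : Iso N M where
  toLinearEquiv := f.toLinearEquiv.symm
  map_op_smul' x b := by
    apply f.toLinearEquiv.injective
    have := f.map_op (f.toLinearEquiv.symm x) b
    change f.toLinearEquiv (f.toLinearEquiv.symm _) = _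
    rw [f.toLinearEquiv.apply_symm_apply]
    refine Eq.trans ?_ this.symm
    change _ = f.toLinearEquiv (f.toLinearEquiv.symm x) <• b
    rw [f.toLinearEquiv.apply_symm_apply]
  map_innerL' x y := by
    obtain ⟨x, rfl⟩ := f.toLinearEquiv.surjective x
    obtain ⟨y, rfl⟩ := f.toLinearEquiv.surjective y
    change M.innerL (f.toLinearEquiv.symm _) (f.toLinearEquiv.symm _) = _
    rw [f.toLinearEquiv.symm_apply_apply, f.toLinearEquiv.symm_apply_apply]
    exact (f.map_innerL x y).symm
  map_innerR' x y := by
    obtain ⟨x, rfl⟩ := f.toLinearEquiv.surjective x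
    obtain ⟨y, rfl⟩ := f.toLinearEquiv.surjective y
    change M.innerR (f.toLinearEquiv.symm _) (f.toLinearEquiv.symm _) = _
    rw [f.toLinearEquiv.symm_apply_apply, f.toLinearEquiv.symm_apply_apply]
    exact (f.map_innerR x y).symm

/-- Composition of isomorphisms. -/
def trans (f : Iso M N) (g : Iso N P) : Iso M P where
  toLinearEquiv := f.toLinearEquiv.trans g.toLinearEquiv
  map_op_smul' x b := by
    change g (f (x <• b)) = g (f x) <• b
    rw [f.map_op, g.map_op]
  map_innerL' x y := by
    change P.innerL (g (f x)) (g (f y)) = _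
    rw [g.map_innerL, f.map_innerL]
  map_innerR' x y := by
    change P.innerR (g (f x)) (g (f y)) = _
    rw [g.map_innerR, f.map_innerR]

end Iso

lemma innerR_add_left (x y z : M) : M.innerR (x + y) z = M.innerR x z + M.innerR y z := by
  rw [← M.star_innerR, M.innerR_add, star_add, M.star_innerR, M.star_innerR]

lemma innerL_add_right (x y z : M) : M.innerL x (y + z) = M.innerL x y + M.innerL x z := by
  rw [← M.star_innerL, M.innerL_add, star_add, M.star_innerL, M.star_innerL]

lemma innerR_smul_left (x y : M) (b : B) : M.innerR (x <• b) y = star b * M.innerR x y := by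
  rw [← M.star_innerR, M.innerR_smul, star_mul, M.star_innerR]

lemma innerL_smul_right (x y : M) (b : B) : M.innerL x (b • y) = M.innerL x y * star b := by
  rw [← M.star_innerL, M.innerL_smul, star_mul, M.star_innerL]

lemma complex_smul_eq (c : ℂ) (x : M) : c • x = (algebraMap ℂ B c) • x := by
  rw [Algebra.algebraMap_eq_smul_one, smul_assoc, one_smul]

lemma complex_smul_eq_op (c : ℂ) (x : M) : c • x = x <• (algebraMap ℂ B c) := by
  rw [Algebra.algebraMap_eq_smul_one, MulOpposite.op_smul, smul_assoc, MulOpposite.op_one, one_smul]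

lemma innerL_csmul (c : ℂ) (x y : M) : M.innerL (c • x) y = c • M.innerL x y := by
  rw [complex_smul_eq, M.innerL_smul, ← Algebra.smul_def]

lemma innerR_csmul (c : ℂ) (x y : M) : M.innerR x (c • y) = c • M.innerR x y := by
  rw [complex_smul_eq_op, M.innerR_smul, ← Algebra.commutes, ← Algebra.smul_def]

/-- The left inner product as an additive map in its first variable. -/
def innerLHom (y : M) : M →+ B where
  toFun x := M.innerL x y
  map_zero' := by simpa using M.innerL_add 0 0 y
  map_add' x x' := M.innerL_add x x' y

/-- The right inner product as an additive map in its second variable. -/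
def innerRHom (x : M) : M →+ B where
  toFun y := M.innerR x y
  map_zero' := by simpa using M.innerR_add x 0 0
  map_add' y y' := M.innerR_add x y y'

lemma eq_zero_of_innerL (x : M) (h : M.innerL x x = 0) : x = 0 := by
  have := M.norm_innerL_self x
  rw [h, norm_zero] at this
  simpa using this.symm

lemma eq_zero_of_innerR (x : M) (h : M.innerR x x = 0) : x = 0 := by
  have := M.norm_innerR_self x
  rw [h, norm_zero] at this
  simpa using this.symm

lemma ext_innerR {x y : M} (h : ∀ z, M.innerR z x = M.innerR z y) : x = y := by
  rw [← sub_eq_zero]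
  apply eq_zero_of_innerR
  have := (innerRHom (x - y)).map_sub x y
  change M.innerR _ _ = M.innerR _ _ - M.innerR _ _ at this
  rw [this, h, sub_self]

lemma ext_innerR' {x y : M} (h : ∀ z, M.innerR x z = M.innerR y z) : x = y :=
  ext_innerR fun z => by rw [← M.star_innerR, h, M.star_innerR]

lemma norm_smul_le' (b : B) (x : M) : ‖b • x‖ ≤ ‖b‖ * ‖x‖ := by
  have h : ‖b • x‖ ^ 2 ≤ (‖b‖ * ‖x‖) ^ 2 := by
    rw [← M.norm_innerL_self, M.innerL_smul, innerL_smul_right, ← mul_assoc]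
    calc _ ≤ ‖b‖ * ‖M.innerL x x‖ * ‖star b‖ := (norm_mul_le _ _).trans (by gcongr; exact norm_mul_le _ _)
      _ = _ := by rw [norm_star, M.norm_innerL_self]; ring
  exact (sq_le_sq₀ (norm_nonneg _) (by positivity)).1 h

lemma norm_op_smul_le (x : M) (b : B) : ‖x <• b‖ ≤ ‖x‖ * ‖b‖ := by
  have h : ‖x <• b‖ ^ 2 ≤ (‖x‖ * ‖b‖) ^ 2 := by
    rw [← M.norm_innerR_self, M.innerR_smul, innerR_smul_left]
    calc _ ≤ ‖star b‖ * ‖M.innerR x x‖ * ‖b‖ := (norm_mul_le _ _).trans (by gcongr; exact norm_mul_le _ _)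
      _ = _ := by rw [norm_star, M.norm_innerR_self]; ring
  exact (sq_le_sq₀ (norm_nonneg _) (by positivity)).1 h

lemma norm_innerR_smul_self_le (a : B) (ha : 0 ≤ a) (x : M) :
    ‖M.innerR x (a • x)‖ ≤ ‖a‖ * ‖x‖ ^ 2 := by
  obtain ⟨s, rfl⟩ := CStarAlgebra.nonneg_iff_eq_star_mul_self.1 ha
  have : M.innerR x ((star s * s) • x) = M.innerR (s • x) (s • x) := by
    rw [M.innerR_adjoint, smul_smul]
  rw [this, M.norm_innerR_self, CStarRing.norm_star_mul_self]
  calc _ ≤ (‖s‖ * ‖x‖) ^ 2 := by gcongr; exact norm_smul_le' s x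
    _ = _ := by ring

lemma norm_innerR_le (x y : M) : ‖M.innerR x y‖ ≤ ‖x‖ * ‖y‖ := by
  have h : ‖M.innerR x y‖ ^ 2 ≤ (‖x‖ * ‖y‖) ^ 2 := by
    rw [sq, ← CStarRing.norm_star_mul_self, M.star_innerR, ← M.innerR_smul, ← M.innerL_smul_eq]
    refine (norm_innerR_smul_self_le _ (M.innerL_self_nonneg x) y).trans ?_
    rw [M.norm_innerL_self, mul_pow]
  exact (sq_le_sq₀ (norm_nonneg _) (by positivity)).1 h

lemma continuous_innerR (x : M) : Continuous fun y => M.innerR x y :=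
  AddMonoidHomClass.continuous_of_bound (innerRHom x) ‖x‖ fun y => norm_innerR_le x y

end MoritaBimodule

/-- A family in `B` with dense span, which is stable under left multiplication, has `1` in its
span. -/
lemma exists_sum_eq_one_of_dense {X : Type*} (f : X → B)
    (hd : Dense (Submodule.span ℂ (Set.range f) : Set B))
    (hmul : ∀ (b : B) (x : X), ∃ x', f x' = b * f x) :
    ∃ c : X →₀ ℂ, ∑ p ∈ c.support, c p • f p = 1 := by
  obtain ⟨a, ha, hab⟩ := Metric.dense_iff.1 hd 1 1 one_pos
  have hu : IsUnit a := by
    have : ‖1 - a‖ < 1 := by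
      have := Metric.mem_ball.1 ha
      rwa [dist_comm, dist_eq_norm] at this
    have h := isUnit_one_sub_of_norm_lt_one this
    simpa using h
  obtain ⟨w, rfl⟩ := hu
  have key : ∀ (b : B), ∀ y ∈ Submodule.span ℂ (Set.range f),
      b * y ∈ Submodule.span ℂ (Set.range f) := by
    intro b y hy
    induction hy using Submodule.span_induction with
    | mem y hy =>
      obtain ⟨x, rfl⟩ := hy
      obtain ⟨x', hx'⟩ := hmul b x
      exact Submodule.subset_span ⟨x', hx'⟩
    | zero => simp
    | add y z _ _ h1 h2 => rw [mul_add]; exact add_mem h1 h2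
    | smul c y _ h => rw [mul_smul_comm]; exact Submodule.smul_mem _ _ h
  have h1 := key (↑w⁻¹) _ hab
  rw [Units.inv_mul] at h1
  obtain ⟨c, hc⟩ := Finsupp.mem_span_range_iff_exists_finsupp.1 h1
  exact ⟨c, hc⟩

namespace MoritaBimodule

variable {M N P : MoritaBimodule B}

lemma exists_frame (M : MoritaBimodule B) :
    ∃ (s : Finset (M × M)) (x y : M × M → M), ∑ i ∈ s, M.innerL (x i) (y i) = 1 := by
  obtain ⟨c, hc⟩ := exists_sum_eq_one_of_dense _ M.innerL_full
    (fun b p => ⟨(b • p.1, p.2), M.innerL_smul _ _ _⟩)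
  refine ⟨c.support, fun p => c p • p.1, fun p => p.2, ?_⟩
  simpa only [innerL_csmul] using hc

lemma faithful {a b : B} (h : ∀ x : M, a • x = b • x) : a = b := by
  obtain ⟨s, x, y, hs⟩ := M.exists_frame
  rw [← mul_one a, ← mul_one b, ← hs, Finset.mul_sum, Finset.mul_sum]
  refine Finset.sum_congr rfl fun i _ => ?_
  rw [← M.innerL_smul, h, M.innerL_smul]

end MoritaBimodule

open MoritaBimodule

variable (B) in
/-- Equivalence of Morita equivalence bimodules. -/
def MoritaBimodule.setoid : Setoid (MoritaBimodule B) where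
  r M N := Nonempty (Iso M N)
  iseqv := ⟨fun M => ⟨Iso.refl M⟩, fun ⟨f⟩ => ⟨f.symm⟩, fun ⟨f⟩ ⟨g⟩ => ⟨f.trans g⟩⟩

variable (B) in
/-- The (underlying set of the) Picard group of `B`: Morita equivalence `B`-bimodules up to
isomorphism. -/
def Pic : Type (u + 1) := Quotient (MoritaBimodule.setoid B)

namespace Pic

/-- The class of a Morita equivalence bimodule. -/
def mk (M : MoritaBimodule B) : Pic B := Quotient.mk (MoritaBimodule.setoid B) M

lemma mk_eq {M N : MoritaBimodule B} : mk M = mk N ↔ Nonempty (Iso M N) :=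
  ⟨fun h => Quotient.exact h, fun h => Quotient.sound h⟩

/-- The graph of the multiplication of the Picard group, i.e. the relation `p * q = r`: the internal
tensor product of a bimodule in `p` with a bimodule in `q` is isomorphic to a bimodule in `r`.
(This does not depend on the representatives, since `TensorIso` can be composed with isomorphisms
in each of its three arguments.) The neutral element is the class of `B`. -/
def IsProd (p q r : Pic B) : Prop :=
  ∃ M N P : MoritaBimodule B, mk M = p ∧ mk N = q ∧ mk P = r ∧ Nonempty (TensorIso M N P)

end Pic

variable (B) in
/-- `UZ(B)`: the group of unitary elements of `B` that lie in the centre of `B`. -/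
def UZ : Subgroup (unitary B) where
  carrier := {w | (w : B) ∈ Set.center B}
  mul_mem' ha hb := Set.mul_mem_center ha hb
  one_mem' := Set.one_mem_center
  inv_mem' {w} hw := by
    change star (w : B) ∈ Set.center B
    exact Set.star_mem_center hw

lemma UZ.comm (w : UZ B) (b : B) : ((w : unitary B) : B) * b = b * ((w : unitary B) : B) :=
  (Set.mem_center_iff.1 w.2).comm b

instance : CommGroup (UZ B) :=
  { (inferInstance : Group (UZ B)) with
    mul_comm := fun a _ => Subtype.ext (Subtype.ext (UZ.comm a _)) }

/-- The element of `B` underlying an element of `UZ(B)`. -/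
def UZ.coe (w : UZ B) : B := ((w : unitary B) : B)

lemma UZ.coe_comm (w : UZ B) (b : B) : UZ.coe w * b = b * UZ.coe w := UZ.comm w b
lemma UZ.coe_mul (w w' : UZ B) : UZ.coe (w * w') = UZ.coe w * UZ.coe w' := rfl
lemma UZ.coe_one : UZ.coe (1 : UZ B) = 1 := rfl
lemma UZ.star_mul_coe (w : UZ B) : star (UZ.coe w) * UZ.coe w = 1 := Unitary.star_mul_self_of_mem w.1.2
lemma UZ.coe_mul_star (w : UZ B) : UZ.coe w * star (UZ.coe w) = 1 := Unitary.mul_star_self_of_mem w.1.2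
lemma UZ.coe_inj {w w' : UZ B} (h : UZ.coe w = UZ.coe w') : w = w' := Subtype.ext (Subtype.ext h)

namespace MoritaBimodule

/-- Right multiplication by a central unitary is left multiplication by a (unique) central
unitary. -/
lemma exists_transport (M : MoritaBimodule B) (w : UZ B) :
    ∃ w' : UZ B, ∀ x : M, x <• (UZ.coe w) = UZ.coe w' • x := by
  have h1 : ∀ c : B, (∀ b, c * b = b * c) → ∃ d : B, ∀ x : M, x <• c = d • x := by
    intro c hc
    obtain ⟨s, x, y, hs⟩ := M.exists_frame
    refine ⟨∑ i ∈ s, M.innerL (x i <• c) (y i), fun z => ?_⟩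
    have : ∀ i, M.innerL (x i <• c) (y i) • z = M.innerL (x i) (y i) • (z <• c) := by
      intro i
      rw [M.innerL_smul_eq, M.innerL_smul_eq, smul_smul, ← MulOpposite.op_mul, hc, M.innerR_smul]
    rw [Finset.sum_smul, Finset.sum_congr rfl fun i _ => this i, ← Finset.sum_smul, hs, one_smul]
  have hc1 : ∀ b, star (UZ.coe w) * b = b * star (UZ.coe w) := UZ.coe_comm w⁻¹
  obtain ⟨d, hd⟩ := h1 (UZ.coe w) (UZ.coe_comm w)
  obtain ⟨d', hd'⟩ := h1 (star (UZ.coe w)) hc1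
  have hcen : ∀ b, d * b = b * d := fun b => M.faithful fun x => by
    rw [mul_smul, ← hd, mul_smul, ← hd, smul_comm b]
  have hdd' : d * d' = 1 := M.faithful fun x => by
    rw [mul_smul, ← hd, ← hd', smul_smul, ← MulOpposite.op_mul, UZ.star_mul_coe]; simp
  have hstar : d' = star d := by
    apply M.faithful
    intro x
    apply ext_innerR'
    intro z
    rw [M.innerR_adjoint (star d), star_star, ← hd, ← hd', M.innerR_smul, innerR_smul_left,
      star_star, UZ.coe_comm]
  have hmem : d ∈ unitary B := by
    rw [hstar] at hdd'
    exact Unitary.mem_iff.2 ⟨by rw [← hcen, hdd'], hdd'⟩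
  exact ⟨⟨⟨d, hmem⟩, Semigroup.mem_center_iff.2 fun b => (hcen b).symm⟩, hd⟩

/-- The automorphism `ψ_M` of `UZ(B)` on elements: `x w = ψ_M(w) x` for all `x ∈ M`. -/
noncomputable def transport (M : MoritaBimodule B) (w : UZ B) : UZ B :=
  (M.exists_transport w).choose

lemma transport_spec (M : MoritaBimodule B) (w : UZ B) (x : M) :
    x <• (UZ.coe w) = UZ.coe (M.transport w) • x := (M.exists_transport w).choose_spec x

lemma transport_eq (M : MoritaBimodule B) {w w' : UZ B} (h : ∀ x : M, x <• (UZ.coe w) = UZ.coe w' • x) :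
    M.transport w = w' :=
  UZ.coe_inj (M.faithful fun x => by rw [← transport_spec, h])

lemma transport_one (M : MoritaBimodule B) : M.transport 1 = 1 :=
  M.transport_eq fun x => by simp [UZ.coe_one]

lemma transport_mul (M : MoritaBimodule B) (w w' : UZ B) :
    M.transport (w * w') = M.transport w * M.transport w' :=
  M.transport_eq fun x => by
    rw [UZ.coe_mul, UZ.coe_mul, mul_smul, ← transport_spec, ← transport_spec, smul_smul,
      ← MulOpposite.op_mul, UZ.coe_comm]

lemma transport_congr {M N : MoritaBimodule B} (f : Iso M N) : M.transport = N.transport := by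
  funext w
  refine M.transport_eq fun x => ?_
  apply f.toLinearEquiv.injective
  change f _ = f _
  rw [f.map_op, f.map_act, transport_spec]

lemma transport_tensor {M N P : MoritaBimodule B} (f : TensorIso M N P) (w : UZ B) :
    P.transport w = M.transport (N.transport w) := by
  refine P.transport_eq fun z => ?_
  have hc1 : Continuous fun z : P => z <• (UZ.coe w) :=
    AddMonoidHomClass.continuous_of_bound
      (DistribSMul.toAddMonoidHom P (MulOpposite.op (UZ.coe w))) ‖UZ.coe w‖
      (fun z => by rw [mul_comm]; exact norm_op_smul_le z _)
  have hc2 : Continuous fun z : P => UZ.coe (M.transport (N.transport w)) • z :=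
    AddMonoidHomClass.continuous_of_bound
      (DistribSMul.toAddMonoidHom P (UZ.coe (M.transport (N.transport w))))
      ‖UZ.coe (M.transport (N.transport w))‖ (fun z => norm_smul_le' _ z)
  refine congrFun (Continuous.ext_on f.dense_range hc1 hc2 ?_) z
  intro z hz
  simp only
  induction hz using Submodule.span_induction with
  | mem z hz =>
    obtain ⟨⟨x, y⟩, rfl⟩ := hz
    simp only
    rw [← f.smul_right, transport_spec, ← f.balanced, transport_spec, f.smul_left]
  | zero => simp
  | add y z _ _ h1 h2 => rw [smul_add, smul_add, h1, h2]
  | smul c y _ h =>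
    rw [complex_smul_eq, ← smul_comm, h, smul_smul, smul_smul, UZ.coe_comm]

end MoritaBimodule

/-- The automorphism of `UZ(B)` induced by an element of the Picard group, on elements. -/
noncomputable def Pic.transport (p : Pic B) : UZ B → UZ B :=
  Quotient.lift (fun M : MoritaBimodule B => M.transport) (fun _ _ h => transport_congr (Classical.choice h)) p

lemma Pic.transport_mk (M : MoritaBimodule B) : (Pic.mk M).transport = M.transport := rfl

lemma Pic.transport_one (p : Pic B) : p.transport 1 = 1 :=
  Quotient.inductionOn p fun M => M.transport_one

lemma Pic.transport_mul (p : Pic B) (w w' : UZ B) :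
    p.transport (w * w') = p.transport w * p.transport w' :=
  Quotient.inductionOn p fun M => M.transport_mul w w'

lemma Pic.IsProd.transport {p q r : Pic B} (h : Pic.IsProd p q r) (w : UZ B) :
    r.transport w = p.transport (q.transport w) := by
  obtain ⟨M, N, P, rfl, rfl, rfl, ⟨f⟩⟩ := h
  exact transport_tensor f w

lemma Pic.transport_self (w : UZ B) : (Pic.mk (self B)).transport w = w :=
  transport_eq (self B) fun x : B => (UZ.coe_comm w x).symm

/-- A group homomorphism `G → Pic(B)`: `ψ(e) = [B]` and `ψ(g) ψ(h) = ψ(g h)`, that is,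
`M_g ⊗_B M_h ≅ M_{gh}` for representatives of the classes. -/
structure PicHom (G : Type v) [Group G] (B : Type u) [CStarAlgebra B] [PartialOrder B]
    [StarOrderedRing B] where
  toFun : G → Pic B
  map_one : toFun 1 = Pic.mk (self B)
  map_mul : ∀ g h, Pic.IsProd (toFun g) (toFun h) (toFun (g * h))

variable {G : Type v} [Group G]

instance : CoeFun (PicHom G B) (fun _ => G → Pic B) := ⟨PicHom.toFun⟩

/-- The `G`-module structure on `UZ(B)` induced by `ψ : G → Pic(B)`: if `M` represents `ψ(g)`, then
`x w = (g · w) x` for all `x ∈ M` and `w ∈ UZ(B)`. -/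
noncomputable def PicHom.action (ψ : PicHom G B) : G →* MulAut (UZ B) where
  toFun g :=
    { toFun := (ψ g).transport
      invFun := (ψ g⁻¹).transport
      left_inv := fun w => by
        have h := (ψ.map_mul g⁻¹ g).transport w
        rw [inv_mul_cancel, ψ.map_one, Pic.transport_self] at h
        exact h.symm
      right_inv := fun w => by
        have h := (ψ.map_mul g g⁻¹).transport w
        rw [mul_inv_cancel, ψ.map_one, Pic.transport_self] at h
        exact h.symm
      map_mul' := (ψ g).transport_mul }
  map_one' := by
    ext1 w
    change (ψ 1).transport w = w
    rw [ψ.map_one, Pic.transport_self]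
  map_mul' g h := by
    ext1 w
    exact (ψ.map_mul g h).transport w

end Basics

/-! ## Second group cohomology, by normalized cochains -/

section Cohomology

variable {G : Type v} [Group G] {A : Type u} [CommGroup A]

/-- Normalized 2-cocycles `ω : G × G → A`: maps with `ω(e, g) = ω(g, e) = 1` and `dω = 1`. -/
def Z2 (α : G →* MulAut A) : Subgroup (G → G → A) where
  carrier := {ω | (∀ g, ω 1 g = 1) ∧ (∀ g, ω g 1 = 1) ∧
    ∀ g h k, α g (ω h k) * (ω (g * h) k)⁻¹ * ω g (h * k) * (ω g h)⁻¹ = 1}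
  one_mem' := by simp
  mul_mem' := by
    rintro a b ⟨a1, a2, a3⟩ ⟨b1, b2, b3⟩
    refine ⟨fun g => by simp [a1, b1], fun g => by simp [a2, b2], fun g h k => ?_⟩
    have := congrArg₂ (· * ·) (a3 g h k) (b3 g h k)
    simp only [mul_one] at this
    rw [← this]
    simp only [Pi.mul_apply, map_mul, mul_inv]
    simp only [mul_comm, mul_left_comm, mul_assoc]
  inv_mem' := by
    rintro a ⟨a1, a2, a3⟩
    refine ⟨fun g => by simp [a1], fun g => by simp [a2], fun g h k => ?_⟩
    have := congrArg (·⁻¹) (a3 g h k)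
    simp only [inv_one] at this
    rw [← this]
    simp only [Pi.inv_apply, map_inv, mul_inv]

/-- Normalized 2-coboundaries: the maps `(dϖ)(g, h) = (g · ϖ(h)) ϖ(gh)⁻¹ ϖ(g)` with
`ϖ : G → A`, `ϖ(e) = 1`. -/
def B2 (α : G →* MulAut A) : Subgroup (G → G → A) where
  carrier := {ω | ∃ w : G → A, w 1 = 1 ∧ ∀ g h, ω g h = α g (w h) * (w (g * h))⁻¹ * w g}
  one_mem' := ⟨1, rfl, by simp⟩
  mul_mem' := by
    rintro a b ⟨w, w1, hw⟩ ⟨w', w1', hw'⟩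
    refine ⟨w * w', by simp [w1, w1'], fun g h => ?_⟩
    simp only [Pi.mul_apply, map_mul, mul_inv, hw, hw']
    simp only [mul_comm, mul_left_comm, mul_assoc]
  inv_mem' := by
    rintro a ⟨w, w1, hw⟩
    refine ⟨w⁻¹, by simp [w1], fun g h => ?_⟩
    simp only [Pi.inv_apply, map_inv, hw, mul_inv]

lemma B2_le_Z2 (α : G →* MulAut A) : B2 α ≤ Z2 α := by
  rintro a ⟨w, w1, hw⟩
  refine ⟨fun g => by simp [hw, w1], fun g => by simp [hw, w1], fun g h k => ?_⟩
  simp only [hw, map_mul, map_inv, mul_inv, inv_inv, MulAut.mul_apply, mul_assoc g h k]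
  apply Additive.ofMul.injective
  simp only [ofMul_mul, ofMul_inv, ofMul_one]
  abel

/-- `H²(G, A)_α = Z²(G, A)_α / B²(G, A)_α`. -/
abbrev H2 (α : G →* MulAut A) : Type (max u v) := Z2 α ⧸ (B2 α).subgroupOf (Z2 α)

end Cohomology

/-! ## Saturated Fell bundles over a discrete group -/

section Bundles

variable {G : Type v} [Group G] {B : Type u} [CStarAlgebra B] [PartialOrder B] [StarOrderedRing B]

/-- A Fell bundle over the discrete group `G` with unit fibre `B`: a family of Banach spaces
`fiber g`, with multiplications `fiber g × fiber h → fiber (g * h)` and involutions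
`fiber g → fiber g⁻¹`, and an identification `unit : B ≃ fiber 1` of the unit fibre with `B`
(as a C⋆-algebra). In order to state the axioms without transporting along equalities in `G`, the
multiplication takes values in `fiber k` for any `k` with `g * h = k`, and the involution in
`fiber h` for any `h` with `g⁻¹ = h`. Over a discrete group the topological conditions on
a Banach bundle and on a Fell bundle are vacuous. -/
structure FellBundle (G : Type v) [Group G] (B : Type u) [CStarAlgebra B] [PartialOrder B]
    [StarOrderedRing B] where
  fiber : G → Type u
  [normedAddCommGroup : ∀ g, NormedAddCommGroup (fiber g)]
  [normedSpace : ∀ g, NormedSpace ℂ (fiber g)]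
  [completeSpace : ∀ g, CompleteSpace (fiber g)]
  mul : ∀ {g h k : G}, g * h = k → fiber g → fiber h → fiber k
  inv : ∀ {g h : G}, g⁻¹ = h → fiber g → fiber h
  mul_assoc' : ∀ {g h k gh hk ghk : G} (e₁ : g * h = gh) (e₂ : gh * k = ghk) (e₃ : h * k = hk)
    (e₄ : g * hk = ghk) (s : fiber g) (t : fiber h) (r : fiber k),
    mul e₂ (mul e₁ s t) r = mul e₄ s (mul e₃ t r)
  add_mul' : ∀ {g h k : G} (e : g * h = k) (s s' : fiber g) (t : fiber h),
    mul e (s + s') t = mul e s t + mul e s' t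
  mul_add' : ∀ {g h k : G} (e : g * h = k) (s : fiber g) (t t' : fiber h),
    mul e s (t + t') = mul e s t + mul e s t'
  smul_mul' : ∀ {g h k : G} (e : g * h = k) (c : ℂ) (s : fiber g) (t : fiber h),
    mul e (c • s) t = c • mul e s t
  mul_smul' : ∀ {g h k : G} (e : g * h = k) (c : ℂ) (s : fiber g) (t : fiber h),
    mul e s (c • t) = c • mul e s t
  norm_mul_le' : ∀ {g h k : G} (e : g * h = k) (s : fiber g) (t : fiber h),
    ‖mul e s t‖ ≤ ‖s‖ * ‖t‖
  inv_add : ∀ {g h : G} (e : g⁻¹ = h) (s s' : fiber g), inv e (s + s') = inv e s + inv e s'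
  inv_smul : ∀ {g h : G} (e : g⁻¹ = h) (c : ℂ) (s : fiber g), inv e (c • s) = star c • inv e s
  inv_mul : ∀ {g h k g' h' k' : G} (e : g * h = k) (eg : g⁻¹ = g') (eh : h⁻¹ = h')
    (ek : k⁻¹ = k') (e' : h' * g' = k') (s : fiber g) (t : fiber h),
    inv ek (mul e s t) = mul e' (inv eh t) (inv eg s)
  inv_inv' : ∀ {g h : G} (e : g⁻¹ = h) (e' : h⁻¹ = g) (s : fiber g), inv e' (inv e s) = s
  norm_inv_mul_self : ∀ {g h k : G} (e : g⁻¹ = h) (e' : h * g = k) (s : fiber g),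
    ‖mul e' (inv e s) s‖ = ‖s‖ ^ 2
  unit : B ≃ₗᵢ[ℂ] fiber 1
  unit_mul : ∀ a b : B, unit (a * b) = mul (mul_one 1) (unit a) (unit b)
  unit_star : ∀ b : B, unit (star b) = inv inv_one (unit b)
  inv_mul_self_nonneg : ∀ {g h : G} (e : g⁻¹ = h) (e' : h * g = 1) (s : fiber g),
    0 ≤ unit.symm (mul e' (inv e s) s)

namespace FellBundle

attribute [instance] normedAddCommGroup normedSpace completeSpace

/-- A Fell bundle is saturated if the span of `B_g B_h` is dense in `B_{gh}` for all `g`, `h`. -/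
def IsSaturated (E : FellBundle G B) : Prop :=
  ∀ {g h k : G} (e : g * h = k), Dense
    (Submodule.span ℂ (Set.range fun p : E.fiber g × E.fiber h => E.mul e p.1 p.2) :
      Set (E.fiber k))

variable {E F D : FellBundle G B}

/-- An equivalence of Fell bundles with unit fibre `B`: a family of surjective linear isometries of
the fibres which is the identity of `B` on the unit fibre and respects multiplication and
involution. -/
structure Equivalence (E F : FellBundle G B) where
  toFun : ∀ g, E.fiber g ≃ₗᵢ[ℂ] F.fiber g
  map_unit : ∀ b, toFun 1 (E.unit b) = F.unit b
  map_mul : ∀ {g h k : G} (e : g * h = k) (s : E.fiber g) (t : E.fiber h),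
    toFun k (E.mul e s t) = F.mul e (toFun g s) (toFun h t)
  map_inv : ∀ {g h : G} (e : g⁻¹ = h) (s : E.fiber g),
    toFun h (E.inv e s) = F.inv e (toFun g s)

namespace Equivalence

/-- The identity equivalence. -/
def refl (E : FellBundle G B) : Equivalence E E where
  toFun _ := LinearIsometryEquiv.refl ℂ _
  map_unit _ := rfl
  map_mul _ _ _ := rfl
  map_inv _ _ := rfl

/-- The inverse equivalence. -/
def symm (f : Equivalence E F) : Equivalence F E where
  toFun g := (f.toFun g).symm
  map_unit b := by rw [← f.map_unit, LinearIsometryEquiv.symm_apply_apply]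
  map_mul e s t := by
    apply (f.toFun _).injective
    rw [f.map_mul]; simp
  map_inv e s := by
    apply (f.toFun _).injective
    rw [f.map_inv]; simp

/-- Composition of equivalences. -/
def trans (f : Equivalence E F) (f' : Equivalence F D) : Equivalence E D where
  toFun g := (f.toFun g).trans (f'.toFun g)
  map_unit b := by simp [f.map_unit, f'.map_unit]
  map_mul e s t := by simp [f.map_mul, f'.map_mul]
  map_inv e s := by simp [f.map_inv, f'.map_inv]

end Equivalence

/-- Left multiplication as a linear map. -/
def mulHom (E : FellBundle G B) {g h k : G} (e : g * h = k) (s : E.fiber g) :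
    E.fiber h →ₗ[ℂ] E.fiber k where
  toFun t := E.mul e s t
  map_add' := E.mul_add' e s
  map_smul' c t := E.mul_smul' e c s t

/-- Right multiplication as a linear map. -/
def mulHom' (E : FellBundle G B) {g h k : G} (e : g * h = k) (t : E.fiber h) :
    E.fiber g →ₗ[ℂ] E.fiber k where
  toFun s := E.mul e s t
  map_add' s s' := E.add_mul' e s s' t
  map_smul' c s := E.smul_mul' e c s t

lemma mul_zero' {g h k : G} (e : g * h = k) (s : E.fiber g) : E.mul e s 0 = 0 :=
  (E.mulHom e s).map_zero

lemma zero_mul' {g h k : G} (e : g * h = k) (t : E.fiber h) : E.mul e 0 t = 0 :=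
  (E.mulHom' e t).map_zero

lemma mul_sub' {g h k : G} (e : g * h = k) (s : E.fiber g) (t t' : E.fiber h) :
    E.mul e s (t - t') = E.mul e s t - E.mul e s t' :=
  (E.mulHom e s).map_sub t t'

lemma eq_zero_of_inv_mul {g h k : G} (e : g⁻¹ = h) (e' : h * g = k) (s : E.fiber g)
    (hs : E.mul e' (E.inv e s) s = 0) : s = 0 := by
  have := E.norm_inv_mul_self e e' s
  rw [hs, norm_zero] at this
  simpa using this.symm

lemma inv_zero' {g h : G} (e : g⁻¹ = h) : E.inv e (0 : E.fiber g) = 0 := by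
  simpa using E.inv_smul e 0 (0 : E.fiber g)

lemma one_mul' {g : G} (s : E.fiber g) : E.mul (one_mul g) (E.unit 1) s = s := by
  have h1 : ∀ r : E.fiber 1, E.mul (one_mul 1) (E.unit 1) r = r := by
    intro r
    obtain ⟨b, rfl⟩ := E.unit.surjective r
    rw [← E.unit_mul, one_mul]
  rw [← sub_eq_zero]
  set d := E.mul (one_mul g) (E.unit 1) s - s with hd
  have hds : E.mul (mul_inv_cancel g) d (E.inv rfl s) = 0 := by
    have h2 := (E.mulHom' (mul_inv_cancel g) (E.inv rfl s)).map_sub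
      (E.mul (one_mul g) (E.unit 1) s) s
    have h3 := E.mul_assoc' (one_mul g) (mul_inv_cancel g) (mul_inv_cancel g) (one_mul 1)
      (E.unit 1) s (E.inv rfl s)
    rw [h1] at h3
    exact h2.trans (sub_eq_zero.2 h3)
  have hinv : E.inv rfl d = E.mul (mul_one g⁻¹) (E.inv rfl s) (E.unit 1) - E.inv rfl s := by
    have h2 := E.inv_mul (one_mul g) inv_one (rfl : g⁻¹ = g⁻¹) rfl (mul_one _) (E.unit 1) s
    rw [← E.unit_star, star_one] at h2
    rw [← h2, eq_sub_iff_add_eq, ← E.inv_add, hd, sub_add_cancel]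
  have hdd : E.mul (mul_inv_cancel g) d (E.inv rfl d) = 0 := by
    rw [hinv, mul_sub', hds, ← E.mul_assoc' (mul_inv_cancel g) (mul_one 1) (mul_one _)
      (mul_inv_cancel g), hds, zero_mul', sub_zero]
  have h0 : E.inv (rfl : g⁻¹ = g⁻¹) d = 0 := by
    apply eq_zero_of_inv_mul (inv_inv g) (mul_inv_cancel g)
    rw [E.inv_inv', hdd]
  rw [← E.inv_inv' (rfl : g⁻¹ = g⁻¹) (inv_inv g) d, h0, inv_zero']

lemma mul_one' {g : G} (s : E.fiber g) : E.mul (mul_one g) s (E.unit 1) = s := by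
  have h := E.inv_mul (one_mul g⁻¹) inv_one (inv_inv g) (inv_inv g) (mul_one g) (E.unit 1)
    (E.inv rfl s)
  rw [one_mul', ← E.unit_star, star_one, E.inv_inv'] at h
  exact h.symm

lemma unit_symm_mul (r r' : E.fiber 1) :
    E.unit.symm (E.mul (mul_one 1) r r') = E.unit.symm r * E.unit.symm r' := by
  apply E.unit.injective
  rw [E.unit_mul]; simp

lemma unit_symm_inv (r : E.fiber 1) : E.unit.symm (E.inv inv_one r) = star (E.unit.symm r) := by
  apply E.unit.injective
  rw [E.unit_star]; simp

lemma norm_inv' {g h : G} (e : g⁻¹ = h) (s : E.fiber g) : ‖E.inv e s‖ = ‖s‖ := by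
  have key : ∀ {g h : G} (e : g⁻¹ = h) (s : E.fiber g), ‖s‖ ≤ ‖E.inv e s‖ := by
    intro g h e s
    have h1 := E.norm_inv_mul_self e rfl s
    have h2 := E.norm_mul_le' (rfl : h * g = h * g) (E.inv e s) s
    rw [h1, sq] at h2
    rcases (norm_nonneg s).eq_or_lt with h0 | h0
    · rw [← h0]; exact norm_nonneg _
    · exact le_of_mul_le_mul_right h2 h0
  refine le_antisymm ?_ (key e s)
  have := key (inv_eq_iff_eq_inv.1 e ▸ rfl : h⁻¹ = g) (E.inv e s)
  rwa [E.inv_inv'] at this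

lemma dense_of_fiber_one {X Y : Type*} (f : X → E.fiber 1) (f' : Y → B)
    (h : ∀ x, ∃ y, f' y = E.unit.symm (f x))
    (hd : Dense (Submodule.span ℂ (Set.range f) : Set (E.fiber 1))) :
    Dense (Submodule.span ℂ (Set.range f') : Set B) := by
  refine (E.unit.symm.surjective.denseRange.dense_image E.unit.symm.continuous hd).mono ?_
  rintro _ ⟨r, hr, rfl⟩
  induction hr using Submodule.span_induction with
  | mem r hr =>
    obtain ⟨x, rfl⟩ := hr
    obtain ⟨y, hy⟩ := h x
    exact Submodule.subset_span ⟨y, hy⟩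
  | zero => simp
  | add r r' _ _ h1 h2 => rw [map_add]; exact add_mem h1 h2
  | smul c r _ h => rw [map_smul]; exact Submodule.smul_mem _ _ h

/-- The fibre of a saturated Fell bundle over `g` as a Morita equivalence `B`-bimodule: the actions
are `b s` and `s b` for `b ∈ B = B_e`, and the inner products are `s t^*` and `s^* t`. -/
noncomputable def bimodule (E : FellBundle G B) (hE : E.IsSaturated) (g : G) : MoritaBimodule B :=
  letI left : Module B (E.fiber g) :=
    { smul := fun b s => E.mul (one_mul g) (E.unit b) s
      one_smul := fun s => one_mul' s
      mul_smul := fun a b s => by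
        change E.mul _ (E.unit (a * b)) s = E.mul _ _ (E.mul _ _ _)
        rw [E.unit_mul, E.mul_assoc']
      smul_zero := fun b => mul_zero' _ _
      smul_add := fun b s t => E.mul_add' _ _ _ _
      add_smul := fun a b s => by
        change E.mul _ (E.unit (a + b)) s = E.mul _ _ _ + E.mul _ _ _
        rw [map_add, E.add_mul']
      zero_smul := fun s => by
        change E.mul _ (E.unit 0) s = 0
        rw [map_zero, zero_mul'] }
  letI right : Module Bᵐᵒᵖ (E.fiber g) :=
    { smul := fun b s => E.mul (mul_one g) s (E.unit b.unop)
      one_smul := fun s => mul_one' s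
      mul_smul := fun a b s => by
        change E.mul _ s (E.unit (b.unop * a.unop)) = E.mul _ (E.mul _ _ _) _
        rw [E.unit_mul, E.mul_assoc']
      smul_zero := fun b => zero_mul' _ _
      smul_add := fun b s t => E.add_mul' _ _ _ _
      add_smul := fun a b s => by
        change E.mul _ s (E.unit (a.unop + b.unop)) = E.mul _ _ _ + E.mul _ _ _
        rw [map_add, E.mul_add']
      zero_smul := fun s => by
        change E.mul _ s (E.unit 0) = 0
        rw [map_zero, mul_zero'] }
  { carrier := E.fiber g
    leftModule := left
    rightModule := right
    smulCommClass := ⟨fun a b s => (E.mul_assoc' _ _ _ _ _ _ _).symm⟩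
    leftTower := ⟨fun c b s => by
      change E.mul _ (E.unit (c • b)) s = c • E.mul _ _ _
      rw [map_smul, E.smul_mul']⟩
    rightTower := ⟨fun c b s => by
      change E.mul _ s (E.unit (c • b.unop)) = c • E.mul _ _ _
      rw [map_smul, E.mul_smul']⟩
    innerL := fun s t => E.unit.symm (E.mul (mul_inv_cancel g) s (E.inv rfl t))
    innerR := fun s t => E.unit.symm (E.mul (inv_mul_cancel g) (E.inv rfl s) t)
    innerL_add := fun s t r => by rw [E.add_mul', map_add]
    innerL_smul := fun b s t => by
      change E.unit.symm (E.mul _ (E.mul _ _ _) _) = _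
      rw [E.mul_assoc' (one_mul g) (mul_inv_cancel g) (mul_inv_cancel g) (one_mul 1),
        unit_symm_mul, LinearIsometryEquiv.symm_apply_apply]
    star_innerL := fun s t => by
      rw [← unit_symm_inv, E.inv_mul (mul_inv_cancel g) rfl (inv_inv g) inv_one
        (mul_inv_cancel g), E.inv_inv']
    innerL_self_nonneg := fun s => by
      have h := E.inv_mul_self_nonneg (inv_inv g) (mul_inv_cancel g) (E.inv rfl s)
      rwa [E.inv_inv'] at h
    norm_innerL_self := fun s => by
      have h := E.norm_inv_mul_self (inv_inv g) (mul_inv_cancel g) (E.inv rfl s)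
      rw [E.inv_inv'] at h
      rw [LinearIsometryEquiv.norm_map, h, norm_inv']
    innerL_full := dense_of_fiber_one _ _
      (fun p => ⟨(p.1, E.inv (inv_inv g) p.2), by
        simp only
        rw [E.inv_inv']⟩) (hE (mul_inv_cancel g))
    innerR_add := fun s t r => by rw [E.mul_add', map_add]
    innerR_smul := fun s t b => by
      change E.unit.symm (E.mul _ _ (E.mul _ _ _)) = _
      rw [← E.mul_assoc' (inv_mul_cancel g) (mul_one 1) (mul_one g) (inv_mul_cancel g),
        unit_symm_mul, LinearIsometryEquiv.symm_apply_apply, MulOpposite.unop_op]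
    star_innerR := fun s t => by
      rw [← unit_symm_inv, E.inv_mul (inv_mul_cancel g) (inv_inv g) rfl inv_one
        (inv_mul_cancel g), E.inv_inv']
    innerR_self_nonneg := fun s => E.inv_mul_self_nonneg _ _ s
    norm_innerR_self := fun s => by
      rw [LinearIsometryEquiv.norm_map, E.norm_inv_mul_self]
    innerR_full := dense_of_fiber_one _ _
      (fun p => ⟨(E.inv (inv_inv g) p.1, p.2), by
        simp only
        rw [E.inv_inv']⟩) (hE (inv_mul_cancel g))
    innerR_adjoint := fun b s t => by
      change E.unit.symm (E.mul _ (E.inv _ (E.mul _ _ _)) _) =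
        E.unit.symm (E.mul _ _ (E.mul _ _ _))
      rw [E.inv_mul (one_mul g) inv_one (rfl : g⁻¹ = g⁻¹) rfl (mul_one _), ← E.unit_star,
        E.mul_assoc']
    innerL_adjoint := fun s b t => by
      change E.unit.symm (E.mul _ (E.mul _ _ _) _) =
        E.unit.symm (E.mul _ _ (E.inv _ (E.mul _ _ _)))
      rw [E.inv_mul (mul_one g) (rfl : g⁻¹ = g⁻¹) inv_one rfl (one_mul _), ← E.unit_star,
        MulOpposite.unop_op, MulOpposite.unop_op, star_star, E.mul_assoc']
    innerL_smul_eq := fun s t r => by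
      change E.mul _ (E.unit (E.unit.symm _)) _ = E.mul _ _ (E.unit (E.unit.symm _))
      rw [LinearIsometryEquiv.apply_symm_apply, LinearIsometryEquiv.apply_symm_apply,
        E.mul_assoc'] }

/-- Equivalent saturated Fell bundles have isomorphic fibres. -/
def Equivalence.fiberIso (f : Equivalence E F) (hE : E.IsSaturated) (hF : F.IsSaturated) (g : G) :
    MoritaBimodule.Iso (E.bimodule hE g) (F.bimodule hF g) where
  toFun := f.toFun g
  map_add' := (f.toFun g).map_add
  map_smul' b := fun s : E.fiber g => by
    change f.toFun g (E.mul _ (E.unit b) s) = F.mul _ (F.unit b) (f.toFun g s)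
    rw [f.map_mul, f.map_unit]
  invFun := (f.toFun g).symm
  left_inv := (f.toFun g).left_inv
  right_inv := (f.toFun g).right_inv
  map_op_smul' := fun (s : E.fiber g) b => by
    change f.toFun g (E.mul _ s (E.unit b)) = F.mul _ (f.toFun g s) (F.unit b)
    rw [f.map_mul, f.map_unit]
  map_innerL' := fun s t : E.fiber g => by
    change F.unit.symm (F.mul _ (f.toFun g s) (F.inv _ (f.toFun g t))) = E.unit.symm _
    rw [← f.map_inv, ← f.map_mul, LinearIsometryEquiv.symm_apply_eq, ← f.map_unit,
      LinearIsometryEquiv.apply_symm_apply]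
  map_innerR' := fun s t : E.fiber g => by
    change F.unit.symm (F.mul _ (F.inv _ (f.toFun g s)) (f.toFun g t)) = E.unit.symm _
    rw [← f.map_inv, ← f.map_mul, LinearIsometryEquiv.symm_apply_eq, ← f.map_unit,
      LinearIsometryEquiv.apply_symm_apply]

end FellBundle

/-- Saturated Fell bundles over `G` with unit fibre `B`. -/
abbrev SatFellBundle (G : Type v) [Group G] (B : Type u) [CStarAlgebra B] [PartialOrder B]
    [StarOrderedRing B] := {E : FellBundle G B // E.IsSaturated}

/-- Equivalence of saturated Fell bundles with unit fibre `B`. -/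
instance SatFellBundle.setoid (G : Type v) [Group G] (B : Type u) [CStarAlgebra B] [PartialOrder B]
    [StarOrderedRing B] : Setoid (SatFellBundle G B) where
  r E F := Nonempty (FellBundle.Equivalence E.1 F.1)
  iseqv := ⟨fun E => ⟨.refl E.1⟩, fun ⟨f⟩ => ⟨f.symm⟩, fun ⟨f⟩ ⟨f'⟩ => ⟨f.trans f'⟩⟩

/-- `Ext(G, B)`: equivalence classes of saturated Fell bundles over `G` with unit fibre `B`. -/
def FellExt (G : Type v) [Group G] (B : Type u) [CStarAlgebra B] [PartialOrder B]
    [StarOrderedRing B] := Quotient (SatFellBundle.setoid G B)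

/-- The map `g ↦ [B_g] ∈ Pic(B)` associated with a class in `Ext(G, B)`. -/
noncomputable def FellExt.picard (x : FellExt G B) : G → Pic B :=
  Quotient.lift (fun E : SatFellBundle G B => fun g => Pic.mk (E.1.bimodule E.2 g))
    (fun E F h => funext fun g => Pic.mk_eq.2 ⟨(Classical.choice h).fiberIso E.2 F.2 g⟩) x

/-- `Ext(G, B, ψ)`: the classes in `Ext(G, B)` with Picard homomorphism `ψ`. -/
def FellExtOf (ψ : PicHom G B) := {x : FellExt G B // x.picard = ψ}

/-! ## Factor systems -/

open MoritaBimodule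

/-- A factor system for `ψ : G → Pic(B)`: bimodules `B_g` representing `ψ(g)`, with an
identification `unit : B ≅ B_e`, and isomorphisms `Ψ_{g,h} : B_g ⊗_B B_h ≅ B_{gh}` which satisfy the
associativity condition and such that `Ψ_{e,e}` is the multiplication of `B`. Here, `Ψ_{g,h}` takes
values in `B_k` for any `k` with `g * h = k`. -/
structure FactorSystem (ψ : PicHom G B) where
  fiber : G → MoritaBimodule B
  mk_fiber : ∀ g, Pic.mk (fiber g) = ψ g
  unit : Iso (self B) (fiber 1)
  map : ∀ {g h k : G}, g * h = k → TensorIso (fiber g) (fiber h) (fiber k)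
  map_unit : ∀ a b : B, map (mul_one 1) (unit a) (unit b) = unit (a * b : B)
  assoc : ∀ {g h k gh hk ghk : G} (e₁ : g * h = gh) (e₂ : gh * k = ghk) (e₃ : h * k = hk)
    (e₄ : g * hk = ghk) (s : fiber g) (t : fiber h) (r : fiber k),
    map e₂ (map e₁ s t) r = map e₄ s (map e₃ t r)

namespace MoritaBimodule

variable {M N P : MoritaBimodule B}

/-- Isomorphisms of Morita equivalence bimodules are isometric. -/
noncomputable def Iso.toIsometry (f : Iso M N) : M ≃ₗᵢ[ℂ] N where
  toLinearEquiv := f.toLinearEquiv.restrictScalars ℂ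
  norm_map' x := by
    have h : ‖f x‖ ^ 2 = ‖x‖ ^ 2 := by
      rw [← M.norm_innerR_self, ← N.norm_innerR_self, f.map_innerR]
    exact (sq_eq_sq₀ (norm_nonneg _) (norm_nonneg _)).1 h

lemma TensorIso.csmul_left (f : TensorIso M N P) (c : ℂ) (x : M) (y : N) :
    f (c • x) y = c • f x y := by
  rw [complex_smul_eq, f.smul_left, ← complex_smul_eq]

lemma TensorIso.csmul_right (f : TensorIso M N P) (c : ℂ) (x : M) (y : N) :
    f x (c • y) = c • f x y := by
  rw [complex_smul_eq_op, f.smul_right, ← complex_smul_eq_op]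

lemma TensorIso.norm_le (f : TensorIso M N P) (x : M) (y : N) : ‖f x y‖ ≤ ‖x‖ * ‖y‖ := by
  have h : ‖f x y‖ ^ 2 ≤ (‖x‖ * ‖y‖) ^ 2 := by
    rw [← P.norm_innerR_self, f.innerR_map]
    refine (norm_innerR_smul_self_le _ (M.innerR_self_nonneg x) y).trans ?_
    rw [M.norm_innerR_self, mul_pow]
  exact (sq_le_sq₀ (norm_nonneg _) (by positivity)).1 h

/-- `f x y` as an additive map in `y`. -/
def TensorIso.rightHom (f : TensorIso M N P) (x : M) : N →+ P where
  toFun y := f x y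
  map_zero' := by simpa using f.csmul_right 0 x 0
  map_add' := f.add_right x

/-- `f x y` as an additive map in `x`. -/
def TensorIso.leftHom (f : TensorIso M N P) (y : N) : M →+ P where
  toFun x := f x y
  map_zero' := by simpa using f.csmul_left 0 0 y
  map_add' x x' := f.add_left x x' y

lemma innerR_csmul_left (c : ℂ) (x y : M) : M.innerR (c • x) y = star c • M.innerR x y := by
  rw [← M.star_innerR, innerR_csmul, star_smul, M.star_innerR]

lemma faithful_op {a b : B} (h : ∀ x : M, x <• a = x <• b) : a = b := by
  obtain ⟨c, hc⟩ := exists_sum_eq_one_of_dense _ M.innerR_full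
    (fun b p => ⟨(p.1 <• star b, p.2), by simp only [innerR_smul_left, star_star]⟩)
  rw [← one_mul a, ← one_mul b, ← hc, Finset.sum_mul, Finset.sum_mul]
  refine Finset.sum_congr rfl fun i _ => ?_
  rw [smul_mul_assoc, smul_mul_assoc, ← M.innerR_smul, h, M.innerR_smul]

end MoritaBimodule

namespace FactorSystem

variable {ψ : PicHom G B} (F : FactorSystem ψ)

/-- The identification `B_e ≅ B`. -/
noncomputable def counit (r : F.fiber 1) : B := F.unit.toLinearEquiv.symm r

lemma counit_unit (b : B) : F.counit (F.unit b) = b := F.unit.toLinearEquiv.symm_apply_apply b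
lemma unit_counit (r : F.fiber 1) : F.unit (F.counit r) = r :=
  F.unit.toLinearEquiv.apply_symm_apply r

lemma counit_add (r r' : F.fiber 1) : F.counit (r + r') = F.counit r + F.counit r' :=
  F.unit.toLinearEquiv.symm.map_add r r'
lemma counit_smul (b : B) (r : F.fiber 1) : F.counit (b • r) = b * F.counit r :=
  F.unit.toLinearEquiv.symm.map_smul b r
lemma counit_csmul (c : ℂ) (r : F.fiber 1) : F.counit (c • r) = c • F.counit r := by
  rw [complex_smul_eq, counit_smul, ← Algebra.smul_def]

/-- `counit` as an additive map. -/
noncomputable def counitHom : F.fiber 1 →+ B := F.unit.toLinearEquiv.symm.toAddMonoidHom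

lemma innerR_one (r r' : F.fiber 1) :
    (F.fiber 1).innerR r r' = star (F.counit r) * F.counit r' := by
  conv_lhs => rw [← F.unit_counit r, ← F.unit_counit r']
  exact F.unit.map_innerR _ _

lemma unit_act_one {g : G} (s : F.fiber g) : F.map (one_mul g) (F.unit (1 : B)) s = s := by
  have h : F.map (one_mul g) (F.unit (1 : B)) (F.map (one_mul g) (F.unit (1 : B)) s - s) = 0 := by
    have h1 := (F.map (one_mul g)).rightHom (F.unit (1 : B)) |>.map_sub
      (F.map (one_mul g) (F.unit (1 : B)) s) s
    refine h1.trans (sub_eq_zero.2 ?_)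
    have h2 := F.assoc (mul_one 1) (one_mul g) (one_mul g) (one_mul g) (F.unit (1 : B))
      (F.unit (1 : B)) s
    rw [F.map_unit, mul_one] at h2
    exact h2.symm
  rw [← sub_eq_zero]
  apply eq_zero_of_innerR
  have h3 := (F.map (one_mul g)).innerR_map (F.unit (1 : B))
    (F.map (one_mul g) (F.unit (1 : B)) s - s) (F.unit (1 : B))
    (F.map (one_mul g) (F.unit (1 : B)) s - s)
  rw [h, innerR_one, counit_unit, star_one, mul_one, one_smul] at h3
  rw [← h3]
  exact (innerRHom _).map_zero

lemma act_unit_one {g : G} (s : F.fiber g) : F.map (mul_one g) s (F.unit (1 : B)) = s := by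
  have h : F.map (mul_one g) (F.map (mul_one g) s (F.unit (1 : B)) - s) (F.unit (1 : B)) = 0 := by
    have h1 := (F.map (mul_one g)).leftHom (F.unit (1 : B)) |>.map_sub
      (F.map (mul_one g) s (F.unit (1 : B))) s
    refine h1.trans (sub_eq_zero.2 ?_)
    have h2 := F.assoc (mul_one g) (mul_one g) (mul_one 1) (mul_one g) s (F.unit (1 : B))
      (F.unit (1 : B))
    rw [F.map_unit, mul_one] at h2
    exact h2
  rw [← sub_eq_zero]
  apply eq_zero_of_innerL
  have h3 := (F.map (mul_one g)).innerL_map (F.map (mul_one g) s (F.unit (1 : B)) - s)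
    (F.unit (1 : B)) (F.map (mul_one g) s (F.unit (1 : B)) - s) (F.unit (1 : B))
  have h4 : (F.fiber 1).innerL (F.unit (1 : B)) (F.unit (1 : B)) = 1 :=
    (F.unit.map_innerL (1 : B) (1 : B)).trans (by simp [self])
  rw [h, h4, MulOpposite.op_one, one_smul] at h3
  rw [← h3]
  exact (innerLHom _).map_zero

/-- `Ψ_{e,g}` is the left action of `B`. -/
lemma map_one_left {g : G} (r : F.fiber 1) (s : F.fiber g) :
    F.map (one_mul g) r s = F.counit r • s := by
  have h : r = F.counit r • F.unit (1 : B) := by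
    have := F.unit.map_act (F.counit r) (1 : B)
    rw [← this]
    change r = F.unit (F.counit r * 1 : B)
    rw [mul_one, unit_counit]
  conv_lhs => rw [h]
  rw [(F.map (one_mul g)).smul_left, unit_act_one]

/-- `Ψ_{g,e}` is the right action of `B`. -/
lemma map_one_right {g : G} (s : F.fiber g) (r : F.fiber 1) :
    F.map (mul_one g) s r = s <• F.counit r := by
  have h : r = F.unit (1 : B) <• F.counit r := by
    have := F.unit.map_op (1 : B) (F.counit r)
    rw [← this]
    change r = F.unit (1 * F.counit r : B)
    rw [one_mul, unit_counit]
  conv_lhs => rw [h]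
  rw [(F.map (mul_one g)).smul_right, act_unit_one]

lemma exists_star {g h : G} (e : g * h = 1) (s : F.fiber g) : ∃ t : F.fiber h,
    (∀ r, (F.fiber h).innerR t r = F.counit (F.map e s r)) ∧
    (∀ v, F.counit (F.map e v t) = (F.fiber g).innerL v s) := by
  have hd : Dense (Submodule.span ℂ (Set.range fun p : F.fiber g × F.fiber h =>
      F.counit (F.map e p.1 p.2)) : Set B) := by
    refine (F.unit.toIsometry.symm.surjective.denseRange.dense_image
      F.unit.toIsometry.symm.continuous (F.map e).dense_range).mono ?_
    rintro _ ⟨r, hr, rfl⟩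
    change F.counit r ∈ _
    induction hr using Submodule.span_induction with
    | mem r hr =>
      obtain ⟨p, rfl⟩ := hr
      exact Submodule.subset_span ⟨p, rfl⟩
    | zero =>
      rw [show F.counit 0 = 0 from F.counitHom.map_zero]
      exact zero_mem _
    | add r r' _ _ h1 h2 => rw [counit_add]; exact add_mem h1 h2
    | smul c r _ h => rw [counit_csmul]; exact Submodule.smul_mem _ _ h
  obtain ⟨c, hc⟩ := exists_sum_eq_one_of_dense _ hd
    (fun b p => ⟨(b • p.1, p.2), by simp only [(F.map e).smul_left, counit_smul]⟩)
  refine ⟨∑ p ∈ c.support, (F.fiber g).innerR s (c p • p.1) • p.2, fun r => ?_, fun v => ?_⟩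
  · rw [← (F.fiber h).star_innerR]
    have h1 : (F.fiber h).innerR r (∑ p ∈ c.support, (F.fiber g).innerR s (c p • p.1) • p.2) =
        ∑ p ∈ c.support, (F.fiber h).innerR r ((F.fiber g).innerR s (c p • p.1) • p.2) :=
      map_sum (innerRHom r) _ _
    rw [h1]
    simp only [← (F.map e).innerR_map, innerR_one, (F.map e).csmul_left, counit_csmul]
    rw [← Finset.mul_sum, hc, mul_one, star_star]
  · have h1 : F.counit (F.map e v (∑ p ∈ c.support, (F.fiber g).innerR s (c p • p.1) • p.2)) =
        ∑ p ∈ c.support, F.counit (F.map e v ((F.fiber g).innerR s (c p • p.1) • p.2)) :=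
      map_sum (F.counitHom.comp ((F.map e).rightHom v)) _ _
    rw [h1]
    simp only [← (F.map e).balanced, ← (F.fiber g).innerL_smul_eq, (F.map e).smul_left,
      counit_smul, (F.map e).csmul_left, counit_csmul]
    rw [← Finset.mul_sum, hc, mul_one]

/-- The involution `B_g → B_{g⁻¹}` of a factor system: `s^* = λ_s^*(1_B)` where
`λ_s : B_{g⁻¹} → B`, `λ_s(r) = Ψ_{g,g⁻¹}(s ⊗ r)`. -/
noncomputable def conj {g h : G} (e : g⁻¹ = h) (s : F.fiber g) : F.fiber h :=
  (F.exists_star (inv_eq_iff_mul_eq_one.1 e) s).choose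

/-- `s^*` is the value at `1_B` of the adjoint of `λ_s`. -/
lemma innerR_conj {g h : G} (e : g⁻¹ = h) (e' : g * h = 1) (s : F.fiber g) (r : F.fiber h) :
    (F.fiber h).innerR (F.conj e s) r = F.counit (F.map e' s r) :=
  (F.exists_star e' s).choose_spec.1 r

lemma counit_mul_conj {g h : G} (e : g⁻¹ = h) (e' : g * h = 1) (v s : F.fiber g) :
    F.counit (F.map e' v (F.conj e s)) = (F.fiber g).innerL v s :=
  (F.exists_star e' s).choose_spec.2 v

lemma counit_conj_mul {g h : G} (e : g⁻¹ = h) (e' : h * g = 1) (s t : F.fiber g) :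
    F.counit (F.map e' (F.conj e s) t) = (F.fiber g).innerR s t := by
  apply (F.fiber g).faithful_op
  intro v
  have e'' : g * h = 1 := inv_eq_iff_mul_eq_one.1 e
  rw [← map_one_right, ← F.assoc e'' (one_mul g) e' (mul_one g), map_one_left,
    counit_mul_conj, (F.fiber g).innerL_smul_eq]

/-- The Fell bundle of a factor system, with multiplication `s t = Ψ_{g,h}(s ⊗ t)` and involution
`s^* = λ_s^*(1_B)`. -/
noncomputable def toFellBundle : FellBundle G B where
  fiber g := F.fiber g
  mul e s t := F.map e s t
  inv e s := F.conj e s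
  mul_assoc' := F.assoc
  add_mul' e := (F.map e).add_left
  mul_add' e := (F.map e).add_right
  smul_mul' e := (F.map e).csmul_left
  mul_smul' e := (F.map e).csmul_right
  norm_mul_le' e := (F.map e).norm_le
  inv_add {g h} e s s' := ext_innerR' fun r => by
    have e' : g * h = 1 := inv_eq_iff_mul_eq_one.1 e
    rw [innerR_add_left, F.innerR_conj e e', F.innerR_conj e e', F.innerR_conj e e',
      (F.map e').add_left, counit_add]
  inv_smul {g h} e c s := ext_innerR' fun r => by
    have e' : g * h = 1 := inv_eq_iff_mul_eq_one.1 e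
    rw [innerR_csmul_left, F.innerR_conj e e', F.innerR_conj e e',
      (F.map e').csmul_left, counit_csmul, star_star]
  inv_mul {g h k g' h' k'} e eg eh ek e' s t := ext_innerR' fun r => by
    have e1 : k * k' = 1 := inv_eq_iff_mul_eq_one.1 ek
    have e2 : g * g' = 1 := inv_eq_iff_mul_eq_one.1 eg
    have e3 : h * h' = 1 := inv_eq_iff_mul_eq_one.1 eh
    refine congrFun (Continuous.ext_on (F.map e').dense_range (continuous_innerR _)
      (continuous_innerR _) ?_) r
    intro r hr
    simp only
    induction hr using Submodule.span_induction with
    | mem r hr =>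
      obtain ⟨⟨a, b⟩, rfl⟩ := hr
      have e4 : h * k' = g' := by rw [← e', ← mul_assoc, e3, one_mul]
      simp only
      rw [(F.map e').innerR_map, F.innerR_conj ek e1, F.innerR_conj eg e2, F.innerR_conj eh e3,
        F.assoc e e1 e4 e2, ← F.assoc e3 (one_mul g') e' e4, map_one_left]
    | zero => exact ((innerRHom _).map_zero).trans ((innerRHom _).map_zero).symm
    | add y z _ _ h1 h2 => rw [innerR_add, innerR_add, h1, h2]
    | smul c y _ h => rw [innerR_csmul, innerR_csmul, h]
  inv_inv' {g h} e e' s := ext_innerR' fun r => by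
    have e'' : h * g = 1 := inv_eq_iff_mul_eq_one.1 e'
    rw [F.innerR_conj e' e'', F.counit_conj_mul e e'']
  norm_inv_mul_self {g h k} e e' s := by
    obtain rfl : 1 = k := by rw [← e', ← e, inv_mul_cancel]
    rw [← (F.fiber g).norm_innerR_self, ← F.counit_conj_mul e e']
    exact (F.unit.toIsometry.symm.norm_map _).symm
  unit := F.unit.toIsometry
  unit_mul a b := (F.map_unit a b).symm
  unit_star b := by
    change F.unit (star b : B) = F.conj inv_one (F.unit b)
    refine ext_innerR' fun r => ?_
    rw [F.innerR_conj inv_one (mul_one 1), innerR_one, counit_unit, map_one_left, counit_unit,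
      counit_smul, star_star]
  inv_mul_self_nonneg {g h} e e' s := by
    change 0 ≤ F.counit (F.map e' (F.conj e s) s)
    rw [F.counit_conj_mul e e']
    exact (F.fiber g).innerR_self_nonneg s

lemma isSaturated_toFellBundle : F.toFellBundle.IsSaturated := fun e => (F.map e).dense_range

/-- The fibres of the Fell bundle of a factor system are the given bimodules. -/
noncomputable def fiberIso (g : G) :
    MoritaBimodule.Iso (F.toFellBundle.bimodule F.isSaturated_toFellBundle g) (F.fiber g) where
  toFun s := s
  invFun s := s
  left_inv _ := rfl
  right_inv _ := rfl
  map_add' _ _ := rfl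
  map_smul' b := fun s : F.fiber g => by
    change F.map (one_mul g) (F.unit b) s = b • s
    rw [map_one_left, counit_unit]
  map_op_smul' := fun (s : F.fiber g) b => by
    change F.map (mul_one g) s (F.unit b) = s <• b
    rw [map_one_right, counit_unit]
  map_innerL' s t := (F.counit_mul_conj rfl (mul_inv_cancel g) s t).symm
  map_innerR' s t := (F.counit_conj_mul rfl (inv_mul_cancel g) s t).symm

/-- The class in `Ext(G, B, ψ)` of the Fell bundle of a factor system for `ψ`. -/
noncomputable def toExt : FellExtOf ψ :=
  ⟨Quotient.mk _ ⟨F.toFellBundle, F.isSaturated_toFellBundle⟩, funext fun g =>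
    (Pic.mk_eq.2 ⟨F.fiberIso g⟩).trans (F.mk_fiber g)⟩

lemma action_apply (g : G) (w : UZ B) : ψ.action g w = (F.fiber g).transport w := by
  change (ψ g).transport w = _
  rw [← F.mk_fiber]
  rfl

lemma map_transport {g h k : G} (e : g * h = k) (w : UZ B) (s : F.fiber g) (t : F.fiber h) :
    F.map e s (UZ.coe w • t) = UZ.coe (ψ.action g w) • F.map e s t := by
  rw [← (F.map e).balanced, transport_spec, (F.map e).smul_left, action_apply]

/-- The twist of a factor system by a 2-cocycle `ω`: the isomorphisms `Ψ_{g,h}` are replaced by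
`ω(g, h) Ψ_{g,h}`. -/
noncomputable def twist (ω : Z2 ψ.action) : FactorSystem ψ where
  fiber := F.fiber
  mk_fiber := F.mk_fiber
  unit := F.unit
  map {g h k} e :=
    { toFun := fun s t => UZ.coe (ω.1 g h) • F.map e s t
      add_left := fun s s' t => by rw [(F.map e).add_left, smul_add]
      add_right := fun s t t' => by rw [(F.map e).add_right, smul_add]
      smul_left := fun b s t => by rw [(F.map e).smul_left, smul_smul, smul_smul, UZ.coe_comm]
      smul_right := fun s t b => by rw [(F.map e).smul_right, smul_comm]
      balanced := fun s b t => by rw [(F.map e).balanced]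
      innerL_map := fun s t s' t' => by
        rw [innerL_smul, innerL_smul_right, (F.map e).innerL_map, ← mul_assoc, UZ.coe_comm,
          mul_assoc, UZ.coe_mul_star, mul_one]
      innerR_map := fun s t s' t' => by
        rw [innerR_adjoint, smul_smul, UZ.star_mul_coe, one_smul, (F.map e).innerR_map]
      dense_range := by
        refine (F.map e).dense_range.mono (Submodule.span_mono ?_)
        rintro _ ⟨⟨s, t⟩, rfl⟩
        refine ⟨(star (UZ.coe (ω.1 g h)) • s, t), ?_⟩
        simp only
        rw [← (F.map e).smul_left, smul_smul, UZ.coe_mul_star, one_smul] }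
  map_unit a b := by
    change UZ.coe (ω.1 1 1) • _ = _
    rw [ω.2.1, UZ.coe_one, one_smul, F.map_unit]
  assoc {g h k gh hk ghk} e₁ e₂ e₃ e₄ s t r := by
    change UZ.coe (ω.1 gh k) • F.map e₂ (UZ.coe (ω.1 g h) • F.map e₁ s t) r =
      UZ.coe (ω.1 g hk) • F.map e₄ s (UZ.coe (ω.1 h k) • F.map e₃ t r)
    rw [(F.map e₂).smul_left, smul_smul, map_transport, smul_smul, F.assoc e₁ e₂ e₃ e₄,
      ← UZ.coe_mul, ← UZ.coe_mul]
    congr 2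
    subst e₁ e₃
    have h := ω.2.2.2 g h k
    rw [mul_inv_eq_one, mul_right_comm, mul_inv_eq_iff_eq_mul] at h
    rw [mul_comm, ← h, mul_comm]

end FactorSystem

end Bundles

/-!
The one analytic input is that two isomorphisms `f, f' : M ⊗ N ≅ P` differ by a unique central
unitary, `f' = w f` (`MoritaBimodule.TensorIso.exists_eq_smul`). Since `B` is unital, fullness of `M`
and `N` writes `1 = ∑ ⟪f aᵢ, f bᵢ⟫_L` with elementary tensors `aᵢ, bᵢ` depending only on `M` and `N`,
so that `w = ∑ ⟪f' aᵢ, f bᵢ⟫_L` can be written down explicitly, with no extension by continuity.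

The rest is bookkeeping with central unitaries. A saturated Fell bundle is the bundle of the factor
system given by its own multiplications (`FellBundle.toFactorSystem`). Two factor systems define the
same class precisely if there are isomorphisms of their fibres that commute with the units and the
multiplications (`FactorSystem.toExt_eq_iff`); compatibility with the involutions is automatic, as the
involution is determined by the multiplication and the inner products. Given two factor systems `F`,
`F'` for the same `ψ`, isomorphisms `φ_g` of their fibres exist, and comparing `φ ∘ Ψ` with
`Ψ' ∘ (φ ⊗ φ)` yields central unitaries `ω(g, h)`; associativity of `Ψ` and `Ψ'` is the cocycle
identity, so `F'` is equivalent to the twist of `F` by `ω`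
(`FactorSystem.exists_toExt_twist_eq`): the action is transitive. An automorphism of a bimodule is
also multiplication by a central unitary, so an equivalence from `F` to its twist by `ω` is the
pointwise inverse of a 1-cochain with coboundary `ω`, and conversely
(`FactorSystem.toExt_twist_eq_self_iff`). This makes the action well defined and free.
-/

/-! ### Uniqueness of bimodule isomorphisms up to central unitaries -/

namespace MoritaBimodule

variable {B : Type u} [CStarAlgebra B] [PartialOrder B] [StarOrderedRing B]
  {M N P M' N' P' : MoritaBimodule B}

lemma innerL_sum_left {ι : Type*} (s : Finset ι) (x : ι → M) (y : M) :
    M.innerL (∑ i ∈ s, x i) y = ∑ i ∈ s, M.innerL (x i) y :=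
  map_sum (innerLHom y) x s

lemma sum_op_smul {ι : Type*} (s : Finset ι) (x : M) (b : ι → B) :
    x <• (∑ i ∈ s, b i) = ∑ i ∈ s, x <• b i := by
  rw [← Finset.sum_smul]
  exact congrArg (· • x) (map_sum (MulOpposite.opAddEquiv (α := B)) b s)

lemma ext_innerL {x y : M} (h : ∀ z, M.innerL x z = M.innerL y z) : x = y := by
  rw [← sub_eq_zero]
  apply eq_zero_of_innerL
  have := (innerLHom (x - y)).map_sub x y
  change M.innerL _ _ = M.innerL _ _ - M.innerL _ _ at this
  rw [this, h, sub_self]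

/-- The elementary tensors of a tensor product contain a frame, which can be chosen independently of
the model `P` of the tensor product. -/
lemma TensorIso.exists_frame (M N : MoritaBimodule B) :
    ∃ (ι : Type u) (s : Finset ι) (x x' : ι → M) (y y' : ι → N),
      ∀ (P : MoritaBimodule B) (f : TensorIso M N P),
        ∑ i ∈ s, P.innerL (f (x i) (y i)) (f (x' i) (y' i)) = 1 := by
  obtain ⟨s, x, x', hs⟩ := M.exists_frame
  obtain ⟨t, y, y', ht⟩ := N.exists_frame
  refine ⟨(M × M) × (N × N), s ×ˢ t, fun p => x p.1, fun p => x' p.1, fun p => y p.2,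
    fun p => y' p.2, fun P f => ?_⟩
  rw [Finset.sum_product, ← hs]
  refine Finset.sum_congr rfl fun i _ => ?_
  simp only [f.innerL_map]
  rw [← innerL_sum_left, ← sum_op_smul, ht, MulOpposite.op_one, one_smul]

/-- The left action of `B` on a tensor product is determined on elementary tensors. -/
lemma TensorIso.eq_of_forall_smul_eq (f : TensorIso M N P) {a b : B}
    (h : ∀ x y, a • f x y = b • f x y) : a = b := by
  obtain ⟨ι, s, x, x', y, y', hs⟩ := TensorIso.exists_frame M N
  rw [← mul_one a, ← mul_one b, ← hs P f, Finset.mul_sum, Finset.mul_sum]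
  refine Finset.sum_congr rfl fun i _ => ?_
  rw [← P.innerL_smul, h, P.innerL_smul]

/-- Tensoring with a Morita equivalence bimodule is faithful on elements. -/
lemma TensorIso.eq_of_forall_apply_eq (f : TensorIso M N P) {x x' : M}
    (h : ∀ y, f x y = f x' y) : x = x' := by
  obtain ⟨s, y, y', hs⟩ := N.exists_frame
  have key : ∀ x z : M, M.innerL x z = ∑ i ∈ s, P.innerL (f x (y i)) (f z (y' i)) := by
    intro x z
    simp only [f.innerL_map]
    rw [← innerL_sum_left, ← sum_op_smul, hs, MulOpposite.op_one, one_smul]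
  exact ext_innerL fun z => by simp only [key, h]

/-- Two isomorphisms `M ⊗ N ≅ P` differ by a central unitary. -/
theorem TensorIso.exists_eq_smul (f f' : TensorIso M N P) :
    ∃ w : UZ B, ∀ x y, f' x y = UZ.coe w • f x y := by
  obtain ⟨ι, s, x, x', y, y', hs⟩ := TensorIso.exists_frame M N
  set w : B := ∑ i ∈ s, P.innerL (f' (x i) (y i)) (f (x' i) (y' i)) with hw
  have key : ∀ a b, w • f a b = f' a b := by
    intro a b
    -- `f` and `f'` carry the same inner products, so `f` may be replaced by `f'` in `⟪f x' y', f a b⟫_R`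
    have h1 : ∀ i, P.innerL (f' (x i) (y i)) (f (x' i) (y' i)) • f a b =
        P.innerL (f' (x i) (y i)) (f' (x' i) (y' i)) • f' a b := by
      intro i
      rw [P.innerL_smul_eq, P.innerL_smul_eq, f.innerR_map, f'.innerR_map]
    rw [hw, Finset.sum_smul, Finset.sum_congr rfl fun i _ => h1 i, ← Finset.sum_smul, hs P f',
      one_smul]
  have hcomm : ∀ b : B, w * b = b * w := fun b => f.eq_of_forall_smul_eq fun a c => by
    rw [mul_smul, mul_smul, key, ← f.smul_left, key, f'.smul_left]
  have hstar : w * star w = 1 := by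
    have h1 : ∑ i ∈ s, P.innerL (w • f (x i) (y i)) (w • f (x' i) (y' i)) = 1 := by
      simp only [key]
      exact hs P f'
    simp only [P.innerL_smul, innerL_smul_right] at h1
    rw [← Finset.mul_sum, ← Finset.sum_mul, hs P f, one_mul] at h1
    exact h1
  have hmem : w ∈ unitary B := Unitary.mem_iff.2 ⟨by rw [← hcomm, hstar], hstar⟩
  exact ⟨⟨⟨w, hmem⟩, Semigroup.mem_center_iff.2 fun b => (hcomm b).symm⟩, fun a b => (key a b).symm⟩

lemma Iso.symm_apply_apply (f : Iso M N) (x : M) : f.symm (f x) = x :=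
  f.toLinearEquiv.symm_apply_apply x

lemma Iso.map_add (f : Iso M N) (x y : M) : f (x + y) = f x + f y :=
  f.toLinearEquiv.map_add x y

/-- Transport of an isomorphism `M' ⊗ N' ≅ P'` along isomorphisms of all three bimodules. -/
noncomputable def TensorIso.congr (f : TensorIso M' N' P') (α : Iso M M') (β : Iso N N')
    (γ : Iso P' P) : TensorIso M N P where
  toFun x y := γ (f (α x) (β y))
  add_left x x' y := by rw [α.map_add, f.add_left, γ.map_add]
  add_right x y y' := by rw [β.map_add, f.add_right, γ.map_add]
  smul_left b x y := by rw [α.map_act, f.smul_left, γ.map_act]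
  smul_right x y b := by rw [β.map_op, f.smul_right, γ.map_op]
  balanced x b y := by rw [α.map_op, β.map_act, f.balanced]
  innerL_map x y x' y' := by
    rw [γ.map_innerL, f.innerL_map, β.map_innerL, ← α.map_op, α.map_innerL]
  innerR_map x y x' y' := by
    rw [γ.map_innerR, f.innerR_map, α.map_innerR, ← β.map_act, β.map_innerR]
  dense_range := by
    refine (γ.toIsometry.surjective.denseRange.dense_image
      γ.toIsometry.continuous f.dense_range).mono ?_
    change ((γ.toIsometry.toLinearEquiv : P' →ₗ[ℂ] P) '' _) ⊆ _
    rw [← Submodule.map_coe, Submodule.map_span, SetLike.coe_subset_coe]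
    refine Submodule.span_mono ?_
    rintro _ ⟨_, ⟨⟨x, y⟩, rfl⟩, rfl⟩
    obtain ⟨x, rfl⟩ := α.surj x
    obtain ⟨y, rfl⟩ := β.surj y
    exact ⟨(x, y), rfl⟩

/-- Multiplication by a central unitary as an automorphism of a bimodule. -/
def unitarySmul (M : MoritaBimodule B) (w : UZ B) : Iso M M where
  toFun x := UZ.coe w • x
  invFun x := star (UZ.coe w) • x
  left_inv x := by simp only [smul_smul, UZ.star_mul_coe, one_smul]
  right_inv x := by simp only [smul_smul, UZ.coe_mul_star, one_smul]
  map_add' := smul_add _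
  map_smul' b x := by
    simp only [RingHom.id_apply]
    rw [smul_smul, smul_smul, UZ.coe_comm]
  map_op_smul' x b := smul_comm _ _ _
  map_innerL' x y := by
    rw [M.innerL_smul, innerL_smul_right, ← mul_assoc, UZ.coe_comm, mul_assoc, UZ.coe_mul_star,
      mul_one]
  map_innerR' x y := by
    rw [M.innerR_adjoint, smul_smul, UZ.star_mul_coe, one_smul]

end MoritaBimodule

section Ext

open MoritaBimodule

variable {G : Type v} [Group G] {B : Type u} [CStarAlgebra B] [PartialOrder B] [StarOrderedRing B]
  {ψ : PicHom G B}

/-! ### Equivalence of factor systems -/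

namespace FactorSystem

/-- An equivalence of factor systems: isomorphisms of the fibres which respect the identifications of
the unit fibres with `B` and the multiplications. -/
structure Equivalence (F F' : FactorSystem ψ) where
  toFun : ∀ g, Iso (F.fiber g) (F'.fiber g)
  map_unit : ∀ b : B, toFun 1 (F.unit b) = F'.unit b
  map_map : ∀ {g h k : G} (e : g * h = k) (s : F.fiber g) (t : F.fiber h),
    toFun k (F.map e s t) = F'.map e (toFun g s) (toFun h t)

/-- The multiplications for an arbitrary `k` with `g * h = k` reduce to those with `k = g * h`. -/
def Equivalence.mk' {F F' : FactorSystem ψ} (φ : ∀ g, Iso (F.fiber g) (F'.fiber g))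
    (h1 : ∀ b : B, φ 1 (F.unit b) = F'.unit b)
    (h2 : ∀ (g h : G) (s : F.fiber g) (t : F.fiber h),
      φ (g * h) (F.map rfl s t) = F'.map rfl (φ g s) (φ h t)) : Equivalence F F' where
  toFun := φ
  map_unit := h1
  map_map e s t := by subst e; exact h2 _ _ s t

variable {F F' : FactorSystem ψ}

lemma Equivalence.counit_apply (φ : Equivalence F F') (r : F.fiber 1) :
    F'.counit (φ.toFun 1 r) = F.counit r := by
  conv_lhs => rw [← F.unit_counit r]
  rw [φ.map_unit, counit_unit]

/-- The involutions are respected as well, since `s^*` is determined by the right inner product and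
the multiplication. -/
lemma Equivalence.map_conj (φ : Equivalence F F') {g h : G} (e : g⁻¹ = h) (s : F.fiber g) :
    φ.toFun h (F.conj e s) = F'.conj e (φ.toFun g s) := by
  refine ext_innerR' fun r => ?_
  obtain ⟨r, rfl⟩ := (φ.toFun h).surj r
  have e' : g * h = 1 := inv_eq_iff_mul_eq_one.1 e
  rw [(φ.toFun h).map_innerR, F.innerR_conj e e', F'.innerR_conj e e', ← φ.map_map,
    φ.counit_apply]

/-- An equivalence of factor systems as an equivalence of their Fell bundles. -/
noncomputable def Equivalence.toFellBundle (φ : Equivalence F F') :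
    FellBundle.Equivalence F.toFellBundle F'.toFellBundle where
  toFun g := (φ.toFun g).toIsometry
  map_unit := φ.map_unit
  map_mul e s t := φ.map_map e s t
  map_inv e s := φ.map_conj e s

/-- An equivalence of the Fell bundles of two factor systems as an equivalence of the factor
systems. -/
noncomputable def Equivalence.ofFellBundle
    (f : FellBundle.Equivalence F.toFellBundle F'.toFellBundle) : Equivalence F F' where
  toFun g := ((F.fiberIso g).symm.trans
    (f.fiberIso F.isSaturated_toFellBundle F'.isSaturated_toFellBundle g)).trans (F'.fiberIso g)
  map_unit := f.map_unit
  map_map e s t := f.map_mul e s t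

/-- Two factor systems define the same class of Fell bundles if and only if they are equivalent. -/
lemma toExt_eq_iff : F.toExt = F'.toExt ↔ Nonempty (Equivalence F F') := by
  constructor
  · intro h
    obtain ⟨f⟩ := Quotient.exact (congrArg Subtype.val h)
    exact ⟨.ofFellBundle f⟩
  · rintro ⟨φ⟩
    exact Subtype.ext (Quotient.sound ⟨φ.toFellBundle⟩)

end FactorSystem

/-! ### The factor system of a saturated Fell bundle -/

namespace FellBundle

/-- The multiplication of a saturated Fell bundle as an isomorphism `B_g ⊗ B_h ≅ B_{gh}`. -/
noncomputable def tensorIso (E : FellBundle G B) (hE : E.IsSaturated) {g h k : G} (e : g * h = k) :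
    TensorIso (E.bimodule hE g) (E.bimodule hE h) (E.bimodule hE k) where
  toFun s t := E.mul e s t
  add_left := E.add_mul' e
  add_right := E.mul_add' e
  smul_left b s t := E.mul_assoc' _ _ _ _ _ _ _
  smul_right s t b := (E.mul_assoc' _ _ _ _ _ _ _).symm
  balanced s b t := E.mul_assoc' _ _ _ _ _ _ _
  innerL_map := fun (s : E.fiber g) (t : E.fiber h) (s' : E.fiber g) (t' : E.fiber h) => by
    subst e
    change E.unit.symm (E.mul _ (E.mul _ s t) (E.inv _ (E.mul _ s' t'))) =
      E.unit.symm (E.mul _ (E.mul _ s (E.unit (E.unit.symm (E.mul _ t (E.inv _ t'))))) (E.inv _ s'))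
    rw [LinearIsometryEquiv.apply_symm_apply,
      E.inv_mul rfl (rfl : g⁻¹ = g⁻¹) (rfl : h⁻¹ = h⁻¹) rfl (mul_inv_rev g h).symm s' t',
      ← E.mul_assoc' (mul_inv_cancel_right g h) (mul_inv_cancel g) (mul_inv_rev g h).symm
        (mul_inv_cancel _),
      E.mul_assoc' rfl (mul_inv_cancel_right g h) (mul_inv_cancel h) (mul_one g)]
  innerR_map := fun (s : E.fiber g) (t : E.fiber h) (s' : E.fiber g) (t' : E.fiber h) => by
    subst e
    change E.unit.symm (E.mul _ (E.inv _ (E.mul _ s t)) (E.mul _ s' t')) =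
      E.unit.symm (E.mul _ (E.inv _ t) (E.mul _ (E.unit (E.unit.symm (E.mul _ (E.inv _ s) s'))) t'))
    rw [LinearIsometryEquiv.apply_symm_apply,
      E.inv_mul rfl (rfl : g⁻¹ = g⁻¹) (rfl : h⁻¹ = h⁻¹) rfl (mul_inv_rev g h).symm s t,
      E.mul_assoc' (mul_inv_rev g h).symm (inv_mul_cancel _) (inv_mul_cancel_left g h)
        (inv_mul_cancel h),
      E.mul_assoc' (inv_mul_cancel g) (one_mul h) rfl (inv_mul_cancel_left g h)]
  dense_range := hE e

/-- The value of `s t^*` does not depend on the expression for the index of the fibre of `t^*`. -/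
lemma mul_inv_congr (E : FellBundle G B) {g h k j j' : G} (e : g * j = k) (e' : g * j' = k)
    (i : h⁻¹ = j) (i' : h⁻¹ = j') (s : E.fiber g) (t : E.fiber h) :
    E.mul e s (E.inv i t) = E.mul e' s (E.inv i' t) := by
  subst i i'
  rfl

/-- The value of `s^* t` does not depend on the expression for the index of the fibre of `s^*`. -/
lemma inv_mul_congr (E : FellBundle G B) {g h k j j' : G} (e : j * h = k) (e' : j' * h = k)
    (i : g⁻¹ = j) (i' : g⁻¹ = j') (s : E.fiber g) (t : E.fiber h) :
    E.mul e (E.inv i s) t = E.mul e' (E.inv i' s) t := by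
  subst i i'
  rfl

/-- The identification of the unit fibre with `B` as an isomorphism of bimodules. -/
noncomputable def unitIso (E : FellBundle G B) (hE : E.IsSaturated) :
    Iso (self B) (E.bimodule hE 1) where
  toFun := E.unit
  invFun := E.unit.symm
  left_inv := E.unit.left_inv
  right_inv := E.unit.right_inv
  map_add' := E.unit.map_add
  map_smul' b := fun a : B => E.unit_mul b a
  map_op_smul' := fun (a : B) b => E.unit_mul a b
  map_innerL' := fun a b : B => by
    change E.unit.symm (E.mul _ (E.unit a) (E.inv _ (E.unit b))) = a * star b
    rw [E.mul_inv_congr _ (mul_one 1) rfl inv_one, ← E.unit_star, ← E.unit_mul,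
      LinearIsometryEquiv.symm_apply_apply]
  map_innerR' := fun a b : B => by
    change E.unit.symm (E.mul _ (E.inv _ (E.unit a)) (E.unit b)) = star a * b
    rw [E.inv_mul_congr _ (mul_one 1) rfl inv_one, ← E.unit_star, ← E.unit_mul,
      LinearIsometryEquiv.symm_apply_apply]

/-- A saturated Fell bundle whose fibres represent `ψ` as a factor system for `ψ`. -/
noncomputable def toFactorSystem (E : FellBundle G B) (hE : E.IsSaturated)
    (h : ∀ g, Pic.mk (E.bimodule hE g) = ψ g) : FactorSystem ψ where
  fiber := E.bimodule hE
  mk_fiber := h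
  unit := E.unitIso hE
  map := E.tensorIso hE
  map_unit a b := (E.unit_mul a b).symm
  assoc := E.mul_assoc'

/-- The Fell bundle of the factor system of `E` is `E`. -/
noncomputable def toFactorSystemEquivalence (E : FellBundle G B) (hE : E.IsSaturated)
    (h : ∀ g, Pic.mk (E.bimodule hE g) = ψ g) :
    Equivalence (E.toFactorSystem hE h).toFellBundle E where
  toFun g := LinearIsometryEquiv.refl ℂ (E.fiber g)
  map_unit _ := rfl
  map_mul _ _ _ := rfl
  map_inv {g h'} e := fun s : E.fiber g => by
    subst e
    change (E.toFactorSystem hE h).conj rfl s = E.inv rfl s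
    refine ext_innerR' (M := E.bimodule hE g⁻¹) fun r : E.fiber g⁻¹ => ?_
    refine ((E.toFactorSystem hE h).innerR_conj rfl (mul_inv_cancel g) s r).trans ?_
    change E.unit.symm (E.mul _ s r) = E.unit.symm (E.mul _ (E.inv _ (E.inv _ s)) r)
    rw [E.inv_mul_congr _ (mul_inv_cancel g) rfl (inv_inv g), E.inv_inv']

end FellBundle

/-- Every class in `Ext(G, B, ψ)` is the class of a factor system. -/
theorem FactorSystem.exists_toExt_eq (x : FellExtOf ψ) : ∃ F : FactorSystem ψ, F.toExt = x := by
  obtain ⟨x, hx⟩ := x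
  induction x using Quotient.inductionOn with
  | h E =>
    have h : ∀ g, Pic.mk (E.1.bimodule E.2 g) = ψ g := congrFun hx
    exact ⟨E.1.toFactorSystem E.2 h,
      Subtype.ext (Quotient.sound ⟨E.1.toFactorSystemEquivalence E.2 h⟩)⟩

/-! ### Twists of factor systems -/

namespace FactorSystem

variable (F F' : FactorSystem ψ)

lemma twist_map (ω : Z2 ψ.action) {g h k : G} (e : g * h = k) (s : F.fiber g) (t : F.fiber h) :
    (F.twist ω).map e s t = UZ.coe (ω.1 g h) • F.map e s t := rfl

/-- An equivalence of factor systems is also one of their twists by the same cocycle. -/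
def Equivalence.twist {F F' : FactorSystem ψ} (φ : Equivalence F F') (ω : Z2 ψ.action) :
    Equivalence (F.twist ω) (F'.twist ω) where
  toFun := φ.toFun
  map_unit := φ.map_unit
  map_map {g h _} e := fun (s : F.fiber g) (t : F.fiber h) => by
    change φ.toFun _ (UZ.coe (ω.1 g h) • F.map e s t) =
      UZ.coe (ω.1 g h) • F'.map e (φ.toFun g s) (φ.toFun h t)
    rw [Iso.map_act, φ.map_map]

lemma toExt_twist_congr {F F' : FactorSystem ψ} (h : F.toExt = F'.toExt) (ω : Z2 ψ.action) :
    (F.twist ω).toExt = (F'.twist ω).toExt := by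
  obtain ⟨φ⟩ := toExt_eq_iff.1 h
  exact toExt_eq_iff.2 ⟨φ.twist ω⟩

lemma toExt_twist_one : (F.twist 1).toExt = F.toExt :=
  toExt_eq_iff.2 ⟨{
    toFun := fun g => Iso.refl (F.fiber g)
    map_unit := fun _ => rfl
    map_map := fun e s t => one_smul B (F.map e s t) }⟩

lemma toExt_twist_mul (ω ω' : Z2 ψ.action) :
    (F.twist (ω * ω')).toExt = ((F.twist ω').twist ω).toExt :=
  toExt_eq_iff.2 ⟨{
    toFun := fun g => Iso.refl (F.fiber g)
    map_unit := fun _ => rfl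
    map_map := fun {g h _} e s t =>
      mul_smul (UZ.coe (ω.1 g h)) (UZ.coe (ω'.1 g h)) (F.map e s t) }⟩

/-- An automorphism of a fibre is multiplication by a central unitary. -/
lemma exists_eq_smul_of_iso {g : G} (φ : Iso (F.fiber g) (F.fiber g)) :
    ∃ w : UZ B, ∀ s, φ s = UZ.coe w • s := by
  -- compare `Ψ_{e,g}` and `φ ∘ Ψ_{e,g}`
  obtain ⟨w, hw⟩ := (F.map (one_mul g)).exists_eq_smul
    ((F.map (one_mul g)).congr (Iso.refl _) (Iso.refl _) φ)
  refine ⟨w, fun s => ?_⟩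
  have h : φ (F.map (one_mul g) (F.unit (1 : B)) s) =
    UZ.coe w • F.map (one_mul g) (F.unit (1 : B)) s := hw (F.unit (1 : B)) s
  rwa [unit_act_one] at h

/-- The product of `u s` and `v t` for central unitaries `u`, `v`. -/
lemma map_smul_smul {g h k : G} (e : g * h = k) (u v : UZ B) (s : F.fiber g) (t : F.fiber h) :
    F.map e (UZ.coe u • s) (UZ.coe v • t) = UZ.coe (u * ψ.action g v) • F.map e s t := by
  rw [(F.map e).smul_left, map_transport, smul_smul, UZ.coe_mul]

/-- The stabilizer of the class of a factor system consists of the coboundaries. -/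
lemma toExt_twist_eq_self_iff (ω : Z2 ψ.action) :
    (F.twist ω).toExt = F.toExt ↔ ω.1 ∈ B2 ψ.action := by
  rw [eq_comm, toExt_eq_iff]
  constructor
  · rintro ⟨φ⟩
    choose w hw using fun g => F.exists_eq_smul_of_iso (φ.toFun g)
    refine ⟨fun g => (w g)⁻¹, ?_, fun g h => ?_⟩
    · rw [inv_eq_one]
      refine UZ.coe_inj ((F.fiber 1).faithful fun r => ?_)
      rw [← hw, ← F.unit_counit r, UZ.coe_one, one_smul]
      exact φ.map_unit _
    · have h1 : w (g * h) = ω.1 g h * (w g * ψ.action g (w h)) := by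
        refine UZ.coe_inj ((F.map (rfl : g * h = g * h)).eq_of_forall_smul_eq fun s t => ?_)
        have h2 : φ.toFun (g * h) (F.map rfl s t) =
          UZ.coe (ω.1 g h) • F.map rfl (φ.toFun g s) (φ.toFun h t) := φ.map_map rfl s t
        rw [UZ.coe_mul, mul_smul, ← map_smul_smul, ← hw, ← hw, ← hw]
        exact h2
      simp only [h1, map_inv, mul_inv, inv_inv]
      apply Additive.ofMul.injective
      simp only [ofMul_mul, ofMul_inv]
      abel
  · rintro ⟨w, hw1, hw⟩
    refine ⟨.mk' (fun g => (F.fiber g).unitarySmul (w g)⁻¹) (fun b => ?_) fun g h s t => ?_⟩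
    · change UZ.coe (w 1)⁻¹ • F.unit b = F.unit b
      rw [hw1, inv_one, UZ.coe_one, one_smul]
    · change UZ.coe (w (g * h))⁻¹ • F.map rfl s t =
        UZ.coe (ω.1 g h) • F.map rfl (UZ.coe (w g)⁻¹ • s) (UZ.coe (w h)⁻¹ • t)
      rw [map_smul_smul, smul_smul, ← UZ.coe_mul, hw, map_inv]
      congr 2
      apply Additive.ofMul.injective
      simp only [ofMul_mul, ofMul_inv]
      abel

/-! ### Transitivity -/

/-- There are isomorphisms of the fibres of two factor systems for the same `ψ` which respect the
identifications of the unit fibres with `B`. -/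
lemma exists_fiber_iso : ∃ φ : ∀ g, Iso (F.fiber g) (F'.fiber g),
    ∀ b : B, φ 1 (F.unit b) = F'.unit b := by
  classical
  have h : ∀ g, Nonempty (Iso (F.fiber g) (F'.fiber g)) := fun g =>
    Pic.mk_eq.1 ((F.mk_fiber g).trans (F'.mk_fiber g).symm)
  let f : Iso (F.fiber 1) (F'.fiber 1) := F.unit.symm.trans F'.unit
  have hf : ∀ b : B, f (F.unit b) = F'.unit b := fun b =>
    congrArg (fun a : B => F'.unit a) (F.unit.symm_apply_apply b)
  let φ : ∀ g, Iso (F.fiber g) (F'.fiber g) := Function.update (fun g => (h g).some) 1 f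
  have hφ : φ 1 = f :=
    Function.update_self (β := fun g => Iso (F.fiber g) (F'.fiber g)) 1 f fun g => (h g).some
  exact ⟨φ, fun b => by rw [hφ]; exact hf b⟩

/-- Two factor systems for the same `ψ` are equivalent up to a twist. -/
theorem exists_toExt_twist_eq : ∃ ω : Z2 ψ.action, (F.twist ω).toExt = F'.toExt := by
  obtain ⟨φ, hφ⟩ := F.exists_fiber_iso F'
  have h1 : ∀ g h, ∃ w : UZ B, ∀ {k} (e : g * h = k) s t,
      F'.map e (φ g s) (φ h t) = UZ.coe w • φ k (F.map e s t) := by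
    intro g h
    obtain ⟨w, hw⟩ := ((F.map rfl).congr (Iso.refl _) (Iso.refl _) (φ (g * h))).exists_eq_smul
      ((F'.map rfl).congr (φ g) (φ h) (Iso.refl _))
    refine ⟨w, fun e s t => ?_⟩
    subst e
    exact hw s t
  choose ω hω using h1
  have hleft : ∀ g, ω 1 g = 1 := fun g => by
    refine UZ.coe_inj ((F'.fiber g).faithful fun z => ?_)
    obtain ⟨z, rfl⟩ := (φ g).surj z
    have h2 := hω 1 g (one_mul g) (F.unit (1 : B)) z
    rw [unit_act_one, hφ, unit_act_one] at h2
    rw [← h2, UZ.coe_one, one_smul]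
  have hright : ∀ g, ω g 1 = 1 := fun g => by
    refine UZ.coe_inj ((F'.fiber g).faithful fun z => ?_)
    obtain ⟨z, rfl⟩ := (φ g).surj z
    have h2 := hω g 1 (mul_one g) z (F.unit (1 : B))
    rw [act_unit_one, hφ, act_unit_one] at h2
    rw [← h2, UZ.coe_one, one_smul]
  have hcoc : ∀ g h k, ω (g * h) k * ω g h = ω g (h * k) * ψ.action g (ω h k) := by
    intro g h k
    -- it suffices to compare the actions on `(x y) z` for elements `x`, `y`, `z` of the three fibres
    refine UZ.coe_inj ((F.map (rfl : g * h = _)).eq_of_forall_smul_eq fun x y =>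
      (F.map (rfl : g * h * k = _)).eq_of_forall_apply_eq fun z => ?_)
    apply (φ (g * h * k)).toLinearEquiv.injective
    change φ _ _ = φ _ _
    have h1 := F'.assoc rfl (rfl : g * h * k = _) rfl (mul_assoc g h k).symm (φ g x) (φ h y) (φ k z)
    rw [hω, hω h k, (F'.map _).smul_left, map_transport, hω, hω g (h * k), smul_smul, smul_smul,
      ← UZ.coe_mul, ← UZ.coe_mul, ← F.assoc rfl rfl rfl (mul_assoc g h k).symm] at h1
    rw [(F.map _).smul_left, (F.map _).smul_left, Iso.map_act, Iso.map_act, mul_comm, h1, mul_comm]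
  refine ⟨⟨ω, hleft, hright, fun g h k => ?_⟩, toExt_eq_iff.2 ⟨.mk' φ hφ fun g h s t => ?_⟩⟩
  · rw [mul_inv_eq_one, mul_right_comm, mul_inv_eq_iff_eq_mul, mul_comm, ← hcoc, mul_comm]
  · exact ((φ (g * h)).map_act (UZ.coe (ω g h)) (F.map rfl s t)).trans (hω g h rfl s t).symm

end FactorSystem

/-! ### The action -/

lemma FactorSystem.toExt_twist_eq_of_mk_eq (F : FactorSystem ψ) {ω ω' : Z2 ψ.action}
    (h : (ω : H2 ψ.action) = (ω' : H2 ψ.action)) :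
    (F.twist ω).toExt = (F.twist ω').toExt := by
  have h1 : ω⁻¹ * ω' ∈ (B2 ψ.action).subgroupOf (Z2 ψ.action) := QuotientGroup.eq.1 h
  rw [← mul_inv_cancel_left ω ω', F.toExt_twist_mul]
  exact (toExt_twist_congr ((F.toExt_twist_eq_self_iff _).2 (Subgroup.mem_subgroupOf.1 h1)) ω).symm

/-- The action of `H²(G, UZ(B))` on `Ext(G, B, ψ)` by twisting factor systems. It is defined by means
of representatives, on which it does not depend by `twistAction_mk_smul`. -/
noncomputable abbrev twistAction (ψ : PicHom G B) : MulAction (H2 ψ.action) (FellExtOf ψ) where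
  smul c x := ((FactorSystem.exists_toExt_eq x).choose.twist c.out).toExt
  one_smul x := by
    have hx := (FactorSystem.exists_toExt_eq x).choose_spec
    refine Eq.trans ?_ hx
    rw [← FactorSystem.toExt_twist_one]
    exact FactorSystem.toExt_twist_eq_of_mk_eq _ (QuotientGroup.out_eq' 1)
  mul_smul c d x := by
    set F := (FactorSystem.exists_toExt_eq x).choose
    have hF := (FactorSystem.exists_toExt_eq (F.twist d.out).toExt).choose_spec
    refine Eq.trans ?_ (FactorSystem.toExt_twist_congr hF c.out).symm
    rw [← FactorSystem.toExt_twist_mul]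
    refine FactorSystem.toExt_twist_eq_of_mk_eq _ ?_
    rw [QuotientGroup.mk_mul]
    simp only [QuotientGroup.out_eq']

lemma twistAction_mk_smul (ω : Z2 ψ.action) (F : FactorSystem ψ) :
    letI := twistAction ψ
    (QuotientGroup.mk ω : H2 ψ.action) • F.toExt = (F.twist ω).toExt :=
  (FactorSystem.toExt_twist_eq_of_mk_eq _ (QuotientGroup.out_eq' _)).trans
    (FactorSystem.toExt_twist_congr (FactorSystem.exists_toExt_eq F.toExt).choose_spec ω)

end Ext

theorem mainTheorem1 {G : Type v} [Group G] {B : Type u} [CStarAlgebra B] [PartialOrder B]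
    [StarOrderedRing B] (ψ : PicHom G B) (hne : Nonempty (FellExtOf ψ)) :
    (∀ x : FellExtOf ψ, ∃ F : FactorSystem ψ, F.toExt = x) ∧
    ∃ _ : MulAction (H2 ψ.action) (FellExtOf ψ),
      (∀ (ω : Z2 ψ.action) (F : FactorSystem ψ),
        (QuotientGroup.mk ω : H2 ψ.action) • F.toExt = (F.twist ω).toExt) ∧
      ∀ x y : FellExtOf ψ, ∃! c : H2 ψ.action, c • x = y := by
  refine ⟨FactorSystem.exists_toExt_eq, twistAction ψ, twistAction_mk_smul, fun x y => ?_⟩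
  obtain ⟨F, rfl⟩ := FactorSystem.exists_toExt_eq x
  obtain ⟨F', rfl⟩ := FactorSystem.exists_toExt_eq y
  obtain ⟨ω, hω⟩ := F.exists_toExt_twist_eq F'
  let := twistAction ψ
  have hF : (QuotientGroup.mk ω : H2 ψ.action) • F.toExt = F'.toExt :=
    (twistAction_mk_smul ω F).trans hω
  refine ⟨QuotientGroup.mk ω, hF, fun c hc => ?_⟩
  -- `ω⁻¹ c` fixes the class of `F`, hence is represented by a coboundary
  have h1 : ((QuotientGroup.mk ω : H2 ψ.action)⁻¹ * c) • F.toExt = F.toExt := by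
    rw [mul_smul, inv_smul_eq_iff]
    exact hc.trans hF.symm
  obtain ⟨σ, rfl⟩ := QuotientGroup.mk_surjective c
  have h2 : (F.twist (ω⁻¹ * σ)).toExt = F.toExt := (twistAction_mk_smul (ω⁻¹ * σ) F).symm.trans h1
  exact (QuotientGroup.eq.2
    (Subgroup.mem_subgroupOf.2 ((F.toExt_twist_eq_self_iff _).1 h2))).symm
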